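/- Let $n\ge 1$. A weight is a nonnegative measurable function $w$ on $(0,\infty)$ with $\int_0^t w(s)\,ds<\infty$ for every $t>0$; "decreasing" means nonincreasing, and for a decreasing weight $w(\infty)=\lim_{t\to\infty}w(t)$. Functions $f$ are real-valued and Lebesgue measurable on $\mathbb R^n$, identified when they agree a.e. Let $f^*(t)=\inf\{s\ge 0:\ |\{|f|>s\}|\le t\}$ be the decreasing rearrangement and $f^{**}(t)=\frac1t\int_0^t f^*(s)\,ds$ the maximal function of $f$. Let $$\Vert f\Vert_{\Lambda^1(w)}=\int_0^\infty f^*(t)w(t)\,dt,\qquad \Vert f\Vert_{\Gamma^1(v)}=\int_0^\infty f^{**}(t)v(t)\,dt,$$ and let $\Lambda^1(w)$, $\Gamma^1(v)$ be the sets of $f$ on which these quantities are finite; $L^1=L^1(\mathbb R^n)$. Two $[0,\infty]$-valued functionals are called equivalent if each is at most a finite constant times the other. Theorem. Let $w$ be a decreasing weight. Then: (i) There exists a weight $v$ such that $\Lambda^1(w)=\Gamma^1(v)$ if and only if $w(\infty)=0$. (ii) $\Lambda^1(w)=L^1$ if and only if $w(\infty)>0$ and $w\in L^\infty(0,\infty)$.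 (iii) There exists a weight $v$ such that $\Lambda^1(w)=\Gamma^1(v)\cap L^1$, $L^1\not\subset\Gamma^1(v)$ and $\Gamma^1(v)\not\subset L^1$ if and only if $w(\infty)>0$ and $w\notin L^\infty(0,\infty)$. Equalities of spaces here are equalities of sets, and they carry equivalence of norms: if, for a weight $v$, $\Lambda^1(w)=\Gamma^1(v)$ (respectively $\Lambda^1(w)=L^1$, $\Lambda^1(w)=\Gamma^1(v)\cap L^1$), then $\Vert\cdot\Vert_{\Lambda^1(w)}$ is equivalent to $\Vert\cdot\Vert_{\Gamma^1(v)}$ (respectively $\Vert\cdot\Vert_{L^1}$, $\Vert\cdot\Vert_{\Gamma^1(v)}+\Vert\cdot\Vert_{L^1}$). Moreover, let $w$ be any weight (not necessarily decreasing) such that $\Lambda^1(w)$ is a Banach space, i.e. $\Lambda^1(w)$ is a vector space carrying a complete norm equivalent to $\Vert\cdot\Vert_{\Lambda^1(w)}$. Then $\Lambda^1(w)$ has a norm equivalent to $\Vert\cdot\Vert_{\Lambda^1(w)}$ which is given by the maximal function in one of the following forms, for some weight $v$: $$\int_0^\infty f^{**}(t)v(t)\,dt,\qquad \sup_{t>0}t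 f^{**}(t),\qquad \int_0^\infty f^{**}(t)v(t)\,dt+\sup_{t>0}t f^{**}(t).$$ -/

import Mathlib

open MeasureTheory Set Filter Topology
open scoped ENNReal NNReal

noncomputable section

/-- Real-valued measurable functions on `ℝⁿ` with Lebesgue measure, modulo equality a.e. -/
abbrev MeasFun (n : ℕ) : Type :=
  EuclideanSpace ℝ (Fin n) →ₘ[(volume : Measure (EuclideanSpace ℝ (Fin n)))] ℝ

/-- A weight: a nonnegative measurable function on `(0, ∞)` whose primitive
`W(t) = ∫₀ᵗ w` is finite for every `t`. Only the values `w t` with `0 < t` play a role. -/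
structure IsWeight (w : ℝ → ℝ) : Prop where
  nonneg : ∀ t, 0 < t → 0 ≤ w t
  measurable : Measurable fun t : Ioi (0 : ℝ) => w t
  integrableOn : ∀ t, 0 < t → IntegrableOn w (Ioc 0 t)

/-- The value at infinity `w(∞) = lim_{t → ∞} w(t)` (the limit exists for decreasing weights). -/
def valueAtInfty (w : ℝ → ℝ) : ℝ := limUnder atTop w

/-- The decreasing rearrangement `f^*(t) = inf {s ≥ 0 : |{|f| > s}| ≤ t}`. -/
def rearr {n : ℕ} (f : MeasFun n) (t : ℝ) : ℝ≥0∞ :=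
  sInf {s : ℝ≥0∞ | volume {x | s < ‖f x‖ₑ} ≤ ENNReal.ofReal t}

/-- The maximal function `f^{**}(t) = (1/t) ∫₀ᵗ f^*(s) ds`, `t > 0`. -/
def maxFun {n : ℕ} (f : MeasFun n) (t : ℝ) : ℝ≥0∞ :=
  (ENNReal.ofReal t)⁻¹ * ∫⁻ s in Ioc 0 t, rearr f s

/-- `‖f‖_{Λ¹(w)} = ∫₀^∞ f^*(t) w(t) dt`. -/
def lambdaNorm (n : ℕ) (w : ℝ → ℝ) (f : MeasFun n) : ℝ≥0∞ :=
  ∫⁻ t in Ioi 0, rearr f t * ENNReal.ofReal (w t)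

/-- `‖f‖_{Γ¹(v)} = ∫₀^∞ f^{**}(t) v(t) dt`. -/
def gammaNorm (n : ℕ) (v : ℝ → ℝ) (f : MeasFun n) : ℝ≥0∞ :=
  ∫⁻ t in Ioi 0, maxFun f t * ENNReal.ofReal (v t)

/-- The functional `sup_{t > 0} t f^{**}(t)`. -/
def supMaxNorm (n : ℕ) (f : MeasFun n) : ℝ≥0∞ :=
  ⨆ t ∈ Ioi (0 : ℝ), ENNReal.ofReal t * maxFun f t

/-- The `L¹` norm. -/
def l1Norm (n : ℕ) (f : MeasFun n) : ℝ≥0∞ := eLpNorm f 1 volume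

/-- The Lorentz space `Λ¹(w)`. -/
def LambdaSpace (n : ℕ) (w : ℝ → ℝ) : Set (MeasFun n) := {f | lambdaNorm n w f < ∞}

/-- The Gamma space `Γ¹(v)`. -/
def GammaSpace (n : ℕ) (v : ℝ → ℝ) : Set (MeasFun n) := {f | gammaNorm n v f < ∞}

/-- The Lebesgue space `L¹(ℝⁿ)`. -/
def L1Space (n : ℕ) : Set (MeasFun n) :=
  ((Lp ℝ 1 (volume : Measure (EuclideanSpace ℝ (Fin n))) : AddSubgroup (MeasFun n)) :
    Set (MeasFun n))

/-- Equivalence `N₁ ≈ N₂` of two `[0, ∞]`-valued functionals; in particular they are finite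
on the same functions. -/
def NormEquiv {n : ℕ} (N₁ N₂ : MeasFun n → ℝ≥0∞) : Prop :=
  ∃ C : ℝ≥0, ∀ f, N₁ f ≤ C * N₂ f ∧ N₂ f ≤ C * N₁ f

/-- `N` is an extended norm: `{N < ∞}` is a vector space, and `N` is a norm on it. -/
structure IsExtNorm {n : ℕ} (N : MeasFun n → ℝ≥0∞) : Prop where
  eq_zero_iff : ∀ f, N f = 0 ↔ f = 0
  add_le : ∀ f g, N (f + g) ≤ N f + N g
  smul : ∀ (c : ℝ) f, N (c • f) = ‖c‖ₑ * N f

/-- The space `{N < ∞}` is complete: Cauchy sequences for `N` converge for `N`. -/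
def IsCompleteFor {n : ℕ} (N : MeasFun n → ℝ≥0∞) : Prop :=
  ∀ u : ℕ → MeasFun n, (∀ k, N (u k) < ∞) →
    (∀ ε : ℝ≥0∞, 0 < ε → ∃ K, ∀ j ≥ K, ∀ k ≥ K, N (u j - u k) < ε) →
    ∃ g, N g < ∞ ∧ Tendsto (fun k => N (u k - g)) atTop (𝓝 0)

/-- `Λ¹(w)` is a Banach space: it is the domain of finiteness of a complete norm equivalent to
`‖·‖_{Λ¹(w)}`. -/
def LambdaIsBanach (n : ℕ) (w : ℝ → ℝ) : Prop :=
  ∃ N : MeasFun n → ℝ≥0∞, IsExtNorm N ∧ IsCompleteFor N ∧ NormEquiv N (lambdaNorm n w)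

end

/-! For decreasing `w`, every functional involved has the form `∫ f^* φ` with `φ` decreasing: `φ =
w` for `Λ¹(w)`, `φ = 1` for `L¹` and for `sup t f^{**}(t)`, and, by Tonelli, `φ(s) = ∫_s^∞ v(t)
dt/t` for `Γ¹(v)`. The last kernel tends to 0 at infinity once it is finite at some point.

Given a decreasing `w`, take `v(t) = w(t) - w(2t)`. Its kernel telescopes to `∫_s^{2s} w(r) dr/r -
w(∞) log 2`, which lies between `log 2 · (w(2s) - w(∞))` and `log 2 · (w(s) - w(∞))`. Dilating by 2
costs only a constant, so `‖f‖_Λ` is equivalent to `‖f‖_Γ + w(∞) ‖f‖_1`; this supplies every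
existence claim.

For the converses, inclusions between such spaces are automatically continuous
(`exists_funNorm_le_mul`, a gliding hump), and norm inequalities tested on balls compare primitives
of weights. A locally integrable decreasing weight vanishing at infinity has primitive `o(t)`, so it
cannot control `L¹` (`not_forall_ofReal_le_primitive`).

For a general weight with primitive `W`, the triangle inequality on disjoint sets of equal volume
gives `W(t) ≤ D (1 + t/s) W(s)`. Hence `W` is comparable to a concave function `K`, and `(K(2t) -
K(t))/t` is a decreasing weight with primitive comparable to `K`. Hardy's lemma then reduces
everything to the decreasing case. -/

noncomputable section

/-- The decreasing rearrangement of a `[0, ∞]`-valued function on a measure space. -/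
def decRearr {α : Type*} [MeasurableSpace α] (μ : Measure α) (F : α → ℝ≥0∞) (t : ℝ) : ℝ≥0∞ :=
  sInf {s : ℝ≥0∞ | μ {x | s < F x} ≤ ENNReal.ofReal t}

/-- The functional `∫₀^∞ F^* φ`. -/
def rearrNorm {α : Type*} [MeasurableSpace α] (μ : Measure α) (φ : ℝ → ℝ≥0∞) (F : α → ℝ≥0∞) :
    ℝ≥0∞ :=
  ∫⁻ t in Ioi 0, decRearr μ F t * φ t

end

/-! ### Decreasing rearrangements, Hardy's lemma and subadditivity -/

section Rearrangement

variable {α : Type*} [MeasurableSpace α] {μ : Measure α} {F G : α → ℝ≥0∞}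

/-- The infimum is attained: `{F > s}` is the increasing union of `{F > u k}` along `u k ↓ s`, so
continuity from below passes the bound to the limit. -/
theorem decRearr_le_iff {t : ℝ} {s : ℝ≥0∞} :
    decRearr μ F t ≤ s ↔ μ {x | s < F x} ≤ ENNReal.ofReal t := by
  refine ⟨fun h => ?_, fun h => sInf_le h⟩
  rcases eq_or_ne s ∞ with rfl | hs
  · simp
  obtain ⟨u, hu, hus, hlim⟩ := exists_seq_strictAnti_tendsto' (lt_top_iff_ne_top.2 hs)
  have hset : {x | s < F x} = ⋃ k, {x | u k < F x} := by
    ext x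
    simp only [mem_ofPred_eq, mem_iUnion]
    refine ⟨fun hx => ((tendsto_order.1 hlim).2 _ hx).exists, ?_⟩
    rintro ⟨k, hk⟩
    exact (hus k).1.trans hk
  have hmono : Monotone fun k => {x | u k < F x} := fun i j hij x hx =>
    lt_of_le_of_lt (hu.antitone hij) hx
  rw [hset, hmono.measure_iUnion]
  refine iSup_le fun k => ?_
  obtain ⟨r, hr, hrk⟩ := sInf_lt_iff.1 (lt_of_le_of_lt h (hus k).1)
  exact (measure_mono fun x hx => hrk.trans hx).trans hr

theorem lt_decRearr_iff {t : ℝ} {s : ℝ≥0∞} :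
    s < decRearr μ F t ↔ ENNReal.ofReal t < μ {x | s < F x} := by
  rw [← not_le, decRearr_le_iff, not_le]

theorem decRearr_antitone (μ : Measure α) (F : α → ℝ≥0∞) : Antitone (decRearr μ F) :=
  fun _ _ h => sInf_le_sInf fun _ hs => le_trans hs (ENNReal.ofReal_le_ofReal h)

theorem measurable_decRearr (μ : Measure α) (F : α → ℝ≥0∞) : Measurable (decRearr μ F) :=
  (decRearr_antitone μ F).measurable

theorem decRearr_mono (h : F ≤ᵐ[μ] G) (t : ℝ) : decRearr μ F t ≤ decRearr μ G t := by
  refine sInf_le_sInf fun s hs => le_trans (measure_mono_ae ?_) hs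
  filter_upwards [h] with x hx hxs using lt_of_lt_of_le hxs hx

theorem volume_restrict_ofReal_lt (c : ℝ≥0∞) :
    (volume.restrict (Ioi (0 : ℝ))) {t | ENNReal.ofReal t < c} = c := by
  rw [Measure.restrict_apply (measurableSet_lt ENNReal.measurable_ofReal measurable_const)]
  rcases eq_or_ne c ∞ with rfl | hc
  · simp
  · have : {t | ENNReal.ofReal t < c} ∩ Ioi 0 = Ioo 0 c.toReal := by
      ext t
      simp only [mem_inter_iff, mem_ofPred_eq, mem_Ioi, mem_Ioo]
      constructor
      · rintro ⟨h, h0⟩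
        exact ⟨h0, (ENNReal.ofReal_lt_iff_lt_toReal h0.le hc).1 h⟩
      · rintro ⟨h0, h⟩
        exact ⟨(ENNReal.ofReal_lt_iff_lt_toReal h0.le hc).2 h, h0⟩
    rw [this, Real.volume_Ioo, sub_zero, ENNReal.ofReal_toReal hc]

/-- Layer cake for functions that may take the value `∞`: `F x` is the length of `{s > 0 | s < F
x}`, and Tonelli applies. -/
theorem lintegral_eq_lintegral_measure_lt [SFinite μ] (hF : Measurable F) :
    ∫⁻ x, F x ∂μ = ∫⁻ s in Ioi (0 : ℝ), μ {x | ENNReal.ofReal s < F x} := by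
  have hS : MeasurableSet {p : α × ℝ | ENNReal.ofReal p.2 < F p.1} :=
    measurableSet_lt (ENNReal.measurable_ofReal.comp measurable_snd) (hF.comp measurable_fst)
  calc ∫⁻ x, F x ∂μ
      = ∫⁻ x, (∫⁻ s in Ioi (0 : ℝ),
          {p : α × ℝ | ENNReal.ofReal p.2 < F p.1}.indicator 1 (x, s)) ∂μ := by
        refine lintegral_congr fun x => ?_
        rw [← volume_restrict_ofReal_lt (F x), ← lintegral_indicator_one
          (measurableSet_lt ENNReal.measurable_ofReal measurable_const)]
        rfl
    _ = ∫⁻ s in Ioi (0 : ℝ), ∫⁻ x,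
          {p : α × ℝ | ENNReal.ofReal p.2 < F p.1}.indicator 1 (x, s) ∂μ :=
        lintegral_lintegral_swap (Measurable.aemeasurable (f := Function.uncurry fun x s =>
          {p : α × ℝ | ENNReal.ofReal p.2 < F p.1}.indicator (1 : α × ℝ → ℝ≥0∞) (x, s))
          (measurable_one.indicator hS))
    _ = _ := by
        refine lintegral_congr fun s => ?_
        rw [← lintegral_indicator_one (measurableSet_lt measurable_const hF)]
        rfl

/-- By `lt_decRearr_iff`, `F` and its rearrangement have the same distribution function. -/
theorem lintegral_decRearr [SFinite μ] (hF : Measurable F) :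
    ∫⁻ t in Ioi 0, decRearr μ F t = ∫⁻ x, F x ∂μ := by
  rw [lintegral_eq_lintegral_measure_lt (measurable_decRearr μ F),
    lintegral_eq_lintegral_measure_lt hF]
  refine lintegral_congr fun s => ?_
  simp_rw [lt_decRearr_iff]
  exact volume_restrict_ofReal_lt _

theorem decRearr_sub_const (a : ℝ≥0∞) (t : ℝ) :
    decRearr μ (fun x => F x - a) t = decRearr μ F t - a := by
  refine eq_of_forall_lt_iff fun s => ?_
  simp_rw [lt_decRearr_iff, lt_tsub_iff_right, lt_decRearr_iff]

/-- One half of the variational formula `∫₀ᵗ F^* = min_a (t a + ∫ (F - a)₊)`. -/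
theorem setLIntegral_decRearr_le [SFinite μ] (hF : Measurable F) (t : ℝ) (a : ℝ≥0∞) :
    ∫⁻ s in Ioc 0 t, decRearr μ F s ≤ ENNReal.ofReal t * a + ∫⁻ x, (F x - a) ∂μ := by
  calc ∫⁻ s in Ioc 0 t, decRearr μ F s
      ≤ ∫⁻ s in Ioc 0 t, (a + (decRearr μ F s - a)) := lintegral_mono fun s => le_add_tsub
    _ = ENNReal.ofReal t * a + ∫⁻ s in Ioc 0 t, (decRearr μ F s - a) := by
        rw [lintegral_add_left measurable_const]
        simp [mul_comm]
    _ ≤ ENNReal.ofReal t * a + ∫⁻ s in Ioi 0, (decRearr μ F s - a) := by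
        gcongr
        exact Ioc_subset_Ioi_self
    _ = _ := by
        simp_rw [← decRearr_sub_const]
        rw [lintegral_decRearr (F := fun x => F x - a) (hF.sub measurable_const)]

/-- The minimum is attained at `a = F^*(t)`, because `(F^* - a)₊` then vanishes beyond `t`. -/
theorem setLIntegral_decRearr_eq [SFinite μ] (hF : Measurable F) (t : ℝ) :
    ∫⁻ s in Ioc 0 t, decRearr μ F s =
      ENNReal.ofReal t * decRearr μ F t + ∫⁻ x, (F x - decRearr μ F t) ∂μ := by
  refine le_antisymm (setLIntegral_decRearr_le hF t _) ?_
  set a := decRearr μ F t with ha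
  have h1 : ∫⁻ x, (F x - a) ∂μ = ∫⁻ s in Ioc 0 t, (decRearr μ F s - a) := by
    rw [← lintegral_decRearr (F := fun x => F x - a) (hF.sub measurable_const)]
    simp_rw [decRearr_sub_const]
    rw [← inter_eq_left.2 (Ioc_subset_Ioi_self : Ioc 0 t ⊆ Ioi 0),
      ← setLIntegral_indicator measurableSet_Ioc]
    refine setLIntegral_congr_fun measurableSet_Ioi fun s hs => ?_
    by_cases hst : s ≤ t
    · rw [indicator_of_mem (show s ∈ Ioc 0 t from ⟨hs, hst⟩)]
    · rw [indicator_of_notMem (fun h : s ∈ Ioc 0 t => hst h.2)]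
      exact tsub_eq_zero_of_le (decRearr_antitone μ F (not_le.1 hst).le)
  rw [h1]
  calc ENNReal.ofReal t * a + ∫⁻ s in Ioc 0 t, (decRearr μ F s - a)
      = ∫⁻ s in Ioc 0 t, (a + (decRearr μ F s - a)) := by
        rw [lintegral_add_left measurable_const]
        simp [mul_comm]
    _ ≤ _ := by
        refine setLIntegral_mono (measurable_decRearr μ F) fun s hs => ?_
        rw [add_tsub_cancel_of_le (decRearr_antitone μ F hs.2)]

/-- In the variational formula, the sum of the levels optimal for `F` and `G` is an admissible level
for `F + G`. -/
theorem setLIntegral_decRearr_add_le [SFinite μ] (hF : Measurable F) (hG : Measurable G) (t : ℝ) :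
    ∫⁻ s in Ioc 0 t, decRearr μ (F + G) s ≤
      (∫⁻ s in Ioc 0 t, decRearr μ F s) + ∫⁻ s in Ioc 0 t, decRearr μ G s := by
  rw [setLIntegral_decRearr_eq hF, setLIntegral_decRearr_eq hG]
  set a := decRearr μ F t
  set b := decRearr μ G t
  calc ∫⁻ s in Ioc 0 t, decRearr μ (F + G) s
      ≤ ENNReal.ofReal t * (a + b) + ∫⁻ x, ((F + G) x - (a + b)) ∂μ :=
        setLIntegral_decRearr_le (hF.add hG) t _
    _ ≤ ENNReal.ofReal t * (a + b) + ∫⁻ x, ((F x - a) + (G x - b)) ∂μ := by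
        gcongr with x
        exact add_tsub_add_le_tsub_add_tsub
    _ = _ := by
        rw [lintegral_add_left (f := fun x => F x - a) (hF.sub measurable_const)]
        ring

/-- An initial segment of `(0, ∞)` may or may not contain its supremum; the closed interval on the
left and the open one on the right of `h` cover both cases. -/
theorem measure_le_of_forall_Ioc {ν₁ ν₂ : Measure ℝ} {C : ℝ≥0∞}
    (h : ∀ t, 0 < t → ν₁ (Ioc 0 t) ≤ C * ν₂ (Ioo 0 t)) {I : Set ℝ} (hI : I ⊆ Ioi 0)
    (hlow : ∀ s ∈ I, ∀ r, 0 < r → r ≤ s → r ∈ I) : ν₁ I ≤ C * ν₂ I := by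
  by_cases hb : BddAbove I
  · rcases I.eq_empty_or_nonempty with rfl | hne
    · simp
    obtain ⟨s, hs⟩ := hne
    have h0 : 0 < sSup I := lt_of_lt_of_le (hI hs) (le_csSup hb hs)
    calc ν₁ I ≤ ν₁ (Ioc 0 (sSup I)) := measure_mono fun r hr => ⟨hI hr, le_csSup hb hr⟩
      _ ≤ C * ν₂ (Ioo 0 (sSup I)) := h _ h0
      _ ≤ C * ν₂ I := by
        gcongr
        rintro r ⟨hr0, hr⟩
        obtain ⟨q, hq, hrq⟩ := exists_lt_of_lt_csSup ⟨s, hs⟩ hr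
        exact hlow q hq r hr0 hrq.le
  · have hall : I = Ioi 0 := by
      refine hI.antisymm fun r hr => ?_
      rw [not_bddAbove_iff] at hb
      obtain ⟨q, hq, hrq⟩ := hb r
      exact hlow q hq r hr hrq.le
    have hU : Ioi (0 : ℝ) = ⋃ k : ℕ, Ioc (0 : ℝ) (k + 1) := by
      ext r
      simp only [mem_Ioi, mem_iUnion, mem_Ioc]
      refine ⟨fun hr => ?_, fun ⟨k, hk⟩ => hk.1⟩
      obtain ⟨k, hk⟩ := exists_nat_ge r
      exact ⟨k, hr, hk.trans (by linarith)⟩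
    have hm : Monotone fun k : ℕ => Ioc (0 : ℝ) (k + 1) := fun i j hij =>
      Ioc_subset_Ioc_right (by have : (i : ℝ) ≤ j := by exact_mod_cast hij
                               linarith)
    rw [hall]
    conv_lhs => rw [hU, hm.measure_iUnion]
    refine iSup_le fun k => (h _ (by positivity)).trans ?_
    gcongr
    exact Ioo_subset_Ioi_self

/-- Hardy's lemma. -/
theorem lintegral_mul_le_of_antitoneOn {g φ ψ : ℝ → ℝ≥0∞} (hg : Measurable g)
    (hga : AntitoneOn g (Ioi 0)) (hφ : Measurable φ) (hψ : Measurable ψ) {C : ℝ≥0∞}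
    (h : ∀ t, 0 < t → ∫⁻ s in Ioc 0 t, φ s ≤ C * ∫⁻ s in Ioc 0 t, ψ s) :
    ∫⁻ t in Ioi 0, g t * φ t ≤ C * ∫⁻ t in Ioi 0, g t * ψ t := by
  -- Layer cake for the measure `χ dt`. The superlevel sets of the decreasing `g` are initial
  -- segments, on which the masses of `φ` and `ψ` can be compared.
  have key : ∀ χ : ℝ → ℝ≥0∞, Measurable χ → ∫⁻ t in Ioi 0, g t * χ t =
      ∫⁻ s in Ioi (0 : ℝ), ((volume.restrict (Ioi 0)).withDensity χ)
        ({t | ENNReal.ofReal s < g t} ∩ Ioi 0) := by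
    intro χ hχ
    have h1 : ∫⁻ t in Ioi 0, g t * χ t = ∫⁻ t, g t ∂((volume.restrict (Ioi 0)).withDensity χ) := by
      rw [lintegral_withDensity_eq_lintegral_mul _ hχ hg]
      simp [mul_comm]
    rw [h1, lintegral_eq_lintegral_measure_lt hg]
    refine lintegral_congr fun s => ?_
    have hms : MeasurableSet {t | ENNReal.ofReal s < g t} := measurableSet_lt measurable_const hg
    rw [withDensity_apply _ hms, withDensity_apply _ (hms.inter measurableSet_Ioi),
      Measure.restrict_restrict hms, Measure.restrict_restrict (hms.inter measurableSet_Ioi),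
      inter_assoc, inter_self]
  have hanti : Antitone fun s : ℝ => ((volume.restrict (Ioi 0)).withDensity ψ)
      ({t | ENNReal.ofReal s < g t} ∩ Ioi 0) := fun r s hrs =>
    measure_mono (inter_subset_inter_left _ fun t ht =>
      lt_of_le_of_lt (ENNReal.ofReal_le_ofReal hrs) ht)
  rw [key φ hφ, key ψ hψ, ← lintegral_const_mul _ hanti.measurable]
  refine lintegral_mono fun s => measure_le_of_forall_Ioc (fun t ht => ?_) inter_subset_right ?_
  · rw [withDensity_apply _ measurableSet_Ioc, withDensity_apply _ measurableSet_Ioo,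
      Measure.restrict_restrict measurableSet_Ioc, Measure.restrict_restrict measurableSet_Ioo,
      inter_eq_left.2 Ioc_subset_Ioi_self, inter_eq_left.2 Ioo_subset_Ioi_self,
      setLIntegral_congr (Ioo_ae_eq_Ioc (μ := volume))]
    exact h t ht
  · rintro q ⟨hq, hq0⟩ r hr hrq
    exact ⟨lt_of_lt_of_le hq (hga hr hq0 hrq), hr⟩

theorem decRearr_const_mul {c : ℝ≥0∞} (h0 : c ≠ 0) (hc : c ≠ ∞) (t : ℝ) :
    decRearr μ (fun x => c * F x) t = c * decRearr μ F t := by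
  refine eq_of_forall_lt_iff fun s => ?_
  have h : ∀ y : ℝ≥0∞, s < c * y ↔ s / c < y := fun y => by
    rw [ENNReal.div_lt_iff (Or.inl h0) (Or.inl hc), mul_comm]
  simp_rw [lt_decRearr_iff, h, lt_decRearr_iff]

theorem decRearr_iSup_of_monotone {H : ℕ → α → ℝ≥0∞} (hH : Monotone H) (t : ℝ) :
    decRearr μ (fun x => ⨆ k, H k x) t = ⨆ k, decRearr μ (H k) t := by
  refine eq_of_forall_lt_iff fun s => ?_
  have hset : {x | s < ⨆ k, H k x} = ⋃ k, {x | s < H k x} := by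
    ext x
    simp [lt_iSup_iff]
  have hm : Monotone fun k => {x | s < H k x} := fun i j hij x hx =>
    lt_of_lt_of_le hx (hH hij x)
  simp_rw [lt_decRearr_iff, hset, hm.measure_iUnion, lt_iSup_iff, lt_decRearr_iff]

variable {φ ψ : ℝ → ℝ≥0∞}

theorem rearrNorm_mono (h : F ≤ᵐ[μ] G) : rearrNorm μ φ F ≤ rearrNorm μ φ G :=
  lintegral_mono fun t => mul_le_mul_left (decRearr_mono h t) _

theorem rearrNorm_congr (h : F =ᵐ[μ] G) : rearrNorm μ φ F = rearrNorm μ φ G :=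
  le_antisymm (rearrNorm_mono h.le) (rearrNorm_mono h.symm.le)

theorem rearrNorm_one [SFinite μ] (hF : Measurable F) : rearrNorm μ 1 F = ∫⁻ x, F x ∂μ := by
  simp [rearrNorm, lintegral_decRearr hF]

theorem rearrNorm_add_weight (hφ : Measurable φ) :
    rearrNorm μ (φ + ψ) F = rearrNorm μ φ F + rearrNorm μ ψ F := by
  simp only [rearrNorm, Pi.add_apply, mul_add]
  exact lintegral_add_left ((measurable_decRearr μ F).mul hφ) _

theorem rearrNorm_const_mul_weight (hφ : Measurable φ) (c : ℝ≥0∞) :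
    rearrNorm μ (fun t => c * φ t) F = c * rearrNorm μ φ F := by
  simp only [rearrNorm, mul_left_comm _ c]
  exact lintegral_const_mul _ ((measurable_decRearr μ F).mul hφ)

theorem rearrNorm_mono_weight (h : ∀ t, 0 < t → φ t ≤ ψ t) :
    rearrNorm μ φ F ≤ rearrNorm μ ψ F :=
  setLIntegral_mono' measurableSet_Ioi fun t ht => mul_le_mul_right (h t ht) _

theorem rearrNorm_congr_weight (h : ∀ t, 0 < t → φ t = ψ t) :
    rearrNorm μ φ F = rearrNorm μ ψ F :=
  le_antisymm (rearrNorm_mono_weight fun t ht => (h t ht).le)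
    (rearrNorm_mono_weight fun t ht => (h t ht).ge)

theorem rearrNorm_le_of_primitive_le (hφ : Measurable φ) (hψ : Measurable ψ) {C : ℝ≥0∞}
    (h : ∀ t, 0 < t → ∫⁻ s in Ioc 0 t, φ s ≤ C * ∫⁻ s in Ioc 0 t, ψ s) :
    rearrNorm μ φ F ≤ C * rearrNorm μ ψ F :=
  lintegral_mul_le_of_antitoneOn (measurable_decRearr μ F)
    ((decRearr_antitone μ F).antitoneOn _) hφ hψ h

/-- Hardy's lemma with the roles exchanged: `φ` is the decreasing function, while `(F + G)^*` and
`F^* + G^*` are the weights whose primitives are compared. -/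
theorem rearrNorm_add_le [SFinite μ] (hF : Measurable F) (hG : Measurable G) (hφ : Measurable φ)
    (hφa : AntitoneOn φ (Ioi 0)) :
    rearrNorm μ φ (F + G) ≤ rearrNorm μ φ F + rearrNorm μ φ G := by
  have h := lintegral_mul_le_of_antitoneOn hφ hφa (measurable_decRearr μ (F + G))
    ((measurable_decRearr μ F).add (measurable_decRearr μ G)) (C := 1) fun t _ => by
      rw [one_mul]
      refine (setLIntegral_decRearr_add_le hF hG t).trans_eq ?_
      exact (lintegral_add_left (measurable_decRearr μ F) _).symm
  rw [one_mul] at h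
  simp only [rearrNorm]
  rw [← lintegral_add_left (f := fun t => decRearr μ F t * φ t) ((measurable_decRearr μ F).mul hφ)]
  simpa [mul_comm, mul_add] using h

theorem rearrNorm_const_mul (hφ : Measurable φ) {c : ℝ≥0∞} (h0 : c ≠ 0)
    (hc : c ≠ ∞) : rearrNorm μ φ (fun x => c * F x) = c * rearrNorm μ φ F := by
  simp only [rearrNorm, decRearr_const_mul h0 hc, mul_assoc]
  exact lintegral_const_mul _ ((measurable_decRearr μ F).mul hφ)

theorem rearrNorm_zero : rearrNorm μ φ (0 : α → ℝ≥0∞) = 0 := by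
  have h : ∀ t, decRearr μ (0 : α → ℝ≥0∞) t = 0 := fun t => by
    rw [← nonpos_iff_eq_zero, decRearr_le_iff]
    simp
  simp [rearrNorm, h]

theorem rearrNorm_iSup_of_monotone {H : ℕ → α → ℝ≥0∞} (hφ : Measurable φ) (hH : Monotone H) :
    rearrNorm μ φ (fun x => ⨆ k, H k x) = ⨆ k, rearrNorm μ φ (H k) := by
  simp only [rearrNorm, decRearr_iSup_of_monotone hH, ENNReal.iSup_mul]
  refine lintegral_iSup (fun k => (measurable_decRearr μ _).mul hφ) fun i j hij t => ?_
  exact mul_le_mul_left (decRearr_mono (Eventually.of_forall (hH hij)) t) _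

theorem rearrNorm_tsum_le [SFinite μ] {H : ℕ → α → ℝ≥0∞} (hH : ∀ k, Measurable (H k))
    (hφ : Measurable φ) (hφa : AntitoneOn φ (Ioi 0)) :
    rearrNorm μ φ (fun x => ∑' k, H k x) ≤ ∑' k, rearrNorm μ φ (H k) := by
  have hfin : ∀ m : ℕ, rearrNorm μ φ (∑ k ∈ Finset.range m, H k) ≤
      ∑ k ∈ Finset.range m, rearrNorm μ φ (H k) := by
    intro m
    induction m with
    | zero => simp [rearrNorm_zero]
    | succ m ih =>
      rw [Finset.sum_range_succ, Finset.sum_range_succ]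
      have hmeas : Measurable (∑ k ∈ Finset.range m, H k) := by
        simpa only [Finset.sum_fn] using Finset.measurable_sum _ fun k _ => hH k
      exact (rearrNorm_add_le hmeas (hH m) hφ hφa).trans (add_le_add_left ih _)
  have hm : Monotone fun m : ℕ => ∑ k ∈ Finset.range m, H k := fun i j hij x => by
    simp only [Finset.sum_apply]
    exact Finset.sum_le_sum_of_subset (Finset.range_mono hij)
  have h := rearrNorm_iSup_of_monotone (μ := μ) hφ hm
  simp only [Finset.sum_apply, ← ENNReal.tsum_eq_iSup_nat] at h
  rw [h]
  exact iSup_le fun m => (hfin m).trans (ENNReal.sum_le_tsum _)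

theorem decRearr_indicator_one (A : Set α) (t : ℝ) :
    decRearr μ (A.indicator 1) t = if ENNReal.ofReal t < μ A then 1 else 0 := by
  refine eq_of_forall_lt_iff fun s => ?_
  rw [lt_decRearr_iff]
  have hset : {x | s < A.indicator (1 : α → ℝ≥0∞) x} = if s < 1 then A else ∅ := by
    ext x
    by_cases hx : x ∈ A <;> by_cases hs : s < 1 <;> simp [hx, hs]
  rw [hset]
  by_cases hs : s < 1
  · split_ifs with h <;> simp [h, hs]
  · split_ifs with h <;> simp [hs]

theorem rearrNorm_indicator_one {A : Set α} {t : ℝ} (hA : μ A = ENNReal.ofReal t) :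
    rearrNorm μ φ (A.indicator 1) = ∫⁻ s in Ioc 0 t, φ s := by
  rcases le_or_gt t 0 with ht | ht
  · simp [rearrNorm, decRearr_indicator_one, hA, ENNReal.ofReal_of_nonpos ht,
      Ioc_eq_empty (not_lt.2 ht)]
  rw [setLIntegral_congr (Ioo_ae_eq_Ioc (μ := volume)).symm, rearrNorm,
    ← inter_eq_left.2 (Ioo_subset_Ioi_self : Ioo 0 t ⊆ Ioi 0),
    ← setLIntegral_indicator measurableSet_Ioo]
  refine setLIntegral_congr_fun measurableSet_Ioi fun s hs => ?_
  simp only [decRearr_indicator_one, hA, ENNReal.ofReal_lt_ofReal_iff ht]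
  by_cases h : s < t
  · rw [if_pos h, indicator_of_mem (show s ∈ Ioo 0 t from ⟨hs, h⟩), one_mul]
  · rw [if_neg h, indicator_of_notMem (fun hh : s ∈ Ioo 0 t => h hh.2), zero_mul]

end Rearrangement

/-! ### Gamma and `L¹` functionals as weighted integrals of `f^*` -/

noncomputable section

/-- A weight as a `[0, ∞]`-valued function on `ℝ`, vanishing on `(-∞, 0]`. -/
def weightFun (w : ℝ → ℝ) : ℝ → ℝ≥0∞ := (Ioi 0).indicator fun t => ENNReal.ofReal (w t)

/-- The kernel `s ↦ ∫_s^∞ v(t) t⁻¹ dt`. -/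
def gammaKernel (v : ℝ → ℝ) (s : ℝ) : ℝ≥0∞ :=
  ∫⁻ t in Ici s, (ENNReal.ofReal t)⁻¹ * weightFun v t

/-- The functional `∫₀^∞ f^* φ` on measurable functions. -/
def funNorm (n : ℕ) (φ : ℝ → ℝ≥0∞) (f : MeasFun n) : ℝ≥0∞ :=
  rearrNorm volume φ fun x => ‖f x‖ₑ

end

section Kernel

theorem weightFun_of_pos (w : ℝ → ℝ) {t : ℝ} (ht : 0 < t) :
    weightFun w t = ENNReal.ofReal (w t) :=
  indicator_of_mem ht _

theorem IsWeight.measurable_weightFun {w : ℝ → ℝ} (hw : IsWeight w) :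
    Measurable (weightFun w) := by
  refine measurable_of_restrict_of_restrict_compl (s := Ioi 0) measurableSet_Ioi ?_ ?_
  · have : (Ioi 0).domRestrict (weightFun w) = fun t : Ioi (0 : ℝ) => ENNReal.ofReal (w t) := by
      ext t
      exact weightFun_of_pos w t.2
    rw [this]
    exact ENNReal.measurable_ofReal.comp hw.measurable
  · have : (Ioi (0 : ℝ))ᶜ.domRestrict (weightFun w) = fun _ => 0 := by
      ext t
      exact indicator_of_notMem (s := Ioi (0 : ℝ)) t.2 fun t => ENNReal.ofReal (w t)
    rw [this]
    exact measurable_const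

theorem antitoneOn_weightFun {w : ℝ → ℝ} (hw : AntitoneOn w (Ioi 0)) :
    AntitoneOn (weightFun w) (Ioi 0) := fun s hs t ht hst => by
  rw [weightFun_of_pos w hs, weightFun_of_pos w ht]
  exact ENNReal.ofReal_le_ofReal (hw hs ht hst)

theorem gammaKernel_antitone (v : ℝ → ℝ) : Antitone (gammaKernel v) := fun _ _ h =>
  lintegral_mono_set (Ici_subset_Ici.2 h)

theorem measurable_gammaKernel (v : ℝ → ℝ) : Measurable (gammaKernel v) :=
  (gammaKernel_antitone v).measurable

variable {n : ℕ}

theorem lambdaNorm_eq_funNorm (w : ℝ → ℝ) (f : MeasFun n) :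
    lambdaNorm n w f = funNorm n (weightFun w) f :=
  rearrNorm_congr_weight (φ := fun t => ENNReal.ofReal (w t)) fun _ ht =>
    (weightFun_of_pos w ht).symm

theorem measurable_enorm_coe (f : MeasFun n) : Measurable fun x => ‖f x‖ₑ := f.measurable.enorm

theorem lintegral_rearr (f : MeasFun n) : ∫⁻ t in Ioi 0, rearr f t = l1Norm n f := by
  rw [l1Norm, eLpNorm_one_eq_lintegral_enorm]
  exact lintegral_decRearr (measurable_enorm_coe f)

theorem l1Norm_eq_funNorm (f : MeasFun n) : l1Norm n f = funNorm n 1 f := by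
  rw [funNorm, rearrNorm_one (measurable_enorm_coe f), l1Norm, eLpNorm_one_eq_lintegral_enorm]

/-- Tonelli on `{s ≤ t}`. Since the kernel is decreasing, Gamma functionals can be treated like
Lorentz functionals with decreasing weights. -/
theorem gammaNorm_eq_funNorm {v : ℝ → ℝ} (hv : IsWeight v) (f : MeasFun n) :
    gammaNorm n v f = funNorm n (gammaKernel v) f := by
  set g : ℝ → ℝ≥0∞ := rearr f with hg
  have hgm : Measurable g := measurable_decRearr _ _
  have hvm := hv.measurable_weightFun
  set k : ℝ → ℝ≥0∞ := fun t => (ENNReal.ofReal t)⁻¹ * weightFun v t with hk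
  have hkm : Measurable k := ENNReal.measurable_ofReal.inv.mul hvm
  have hS : MeasurableSet {p : ℝ × ℝ | p.2 ≤ p.1} := measurableSet_le measurable_snd measurable_fst
  let H : ℝ → ℝ → ℝ≥0∞ := fun t s =>
    {p : ℝ × ℝ | p.2 ≤ p.1}.indicator (fun p => g p.2 * k p.1) (t, s)
  have hHm : Measurable (Function.uncurry H) :=
    ((hgm.comp measurable_snd).mul (hkm.comp measurable_fst)).indicator hS
  calc gammaNorm n v f = ∫⁻ t in Ioi (0 : ℝ), ∫⁻ s in Ioi (0 : ℝ), H t s := by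
        refine setLIntegral_congr_fun measurableSet_Ioi fun t ht => ?_
        have h1 : ∫⁻ s in Ioi (0 : ℝ), H t s = ∫⁻ s in Iic t ∩ Ioi 0, g s * k t := by
          rw [← setLIntegral_indicator measurableSet_Iic]
          rfl
        have h2 : Iic t ∩ Ioi 0 = Ioc 0 t := by rw [inter_comm]; rfl
        rw [h1, h2, lintegral_mul_const _ hgm, hk]
        simp only [maxFun, weightFun_of_pos v ht]
        ring
    _ = ∫⁻ s in Ioi (0 : ℝ), ∫⁻ t in Ioi (0 : ℝ), H t s :=
        lintegral_lintegral_swap hHm.aemeasurable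
    _ = funNorm n (gammaKernel v) f := by
        refine setLIntegral_congr_fun measurableSet_Ioi fun s hs => ?_
        have h1 : ∫⁻ t in Ioi (0 : ℝ), H t s = ∫⁻ t in Ici s ∩ Ioi 0, g s * k t := by
          rw [← setLIntegral_indicator measurableSet_Ici]
          rfl
        have h2 : Ici s ∩ Ioi 0 = Ici s :=
          inter_eq_left.2 fun t ht => mem_Ioi.2 (lt_of_lt_of_le (mem_Ioi.1 hs) ht)
        simp only [h1, h2]
        exact lintegral_const_mul _ hkm

theorem iSup_setLIntegral_Ioc (g : ℝ → ℝ≥0∞) :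
    ⨆ t ∈ Ioi (0 : ℝ), ∫⁻ s in Ioc 0 t, g s = ∫⁻ s in Ioi 0, g s := by
  refine le_antisymm (iSup₂_le fun t _ => lintegral_mono_set Ioc_subset_Ioi_self) ?_
  have hU : Ioi (0 : ℝ) = ⋃ k : ℕ, Ioc (0 : ℝ) (k + 1) := by
    ext r
    simp only [mem_Ioi, mem_iUnion, mem_Ioc]
    refine ⟨fun hr => ?_, fun ⟨k, hk⟩ => hk.1⟩
    obtain ⟨k, hk⟩ := exists_nat_ge r
    exact ⟨k, hr, hk.trans (by linarith)⟩
  have hm : Monotone fun k : ℕ => Ioc (0 : ℝ) (k + 1) := fun i j hij =>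
    Ioc_subset_Ioc_right (by have : (i : ℝ) ≤ j := by exact_mod_cast hij
                             linarith)
  conv_lhs => rw [hU, setLIntegral_iUnion_of_directed _ hm.directed_le]
  exact iSup_le fun k => le_iSup₂_of_le ((k : ℝ) + 1) (mem_Ioi.2 (by positivity)) le_rfl

/-- `t f^{**}(t) = ∫₀ᵗ f^*` increases to `∫₀^∞ f^*`. -/
theorem supMaxNorm_eq_l1Norm (f : MeasFun n) : supMaxNorm n f = l1Norm n f := by
  rw [← lintegral_rearr, ← iSup_setLIntegral_Ioc]
  refine biSup_congr fun t ht => ?_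
  have h0 : ENNReal.ofReal t ≠ 0 := by simpa using ht
  rw [maxFun, ← mul_assoc, ENNReal.mul_inv_cancel h0 ENNReal.ofReal_ne_top, one_mul]

end Kernel

/-! ### Functionals on measurable functions; automatic continuity of inclusions -/

section FunNorm

variable {n : ℕ} {φ ψ : ℝ → ℝ≥0∞}

theorem funNorm_add_le (hφ : Measurable φ) (hφa : AntitoneOn φ (Ioi 0)) (f g : MeasFun n) :
    funNorm n φ (f + g) ≤ funNorm n φ f + funNorm n φ g := by
  refine le_trans (rearrNorm_mono ?_)
    (rearrNorm_add_le (measurable_enorm_coe f) (measurable_enorm_coe g) hφ hφa)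
  filter_upwards [AEEqFun.coeFn_add f g] with x hx
  rw [hx]
  exact enorm_add_le _ _

theorem funNorm_zero : funNorm n φ 0 = 0 := by
  rw [← rearrNorm_zero (μ := (volume : Measure (EuclideanSpace ℝ (Fin n)))) (φ := φ)]
  refine rearrNorm_congr ?_
  filter_upwards [AEEqFun.coeFn_zero (μ := (volume : Measure (EuclideanSpace ℝ (Fin n))))
    (β := ℝ)] with x hx
  simp [hx]

theorem funNorm_smul (hφ : Measurable φ) (c : ℝ) (f : MeasFun n) :
    funNorm n φ (c • f) = ‖c‖ₑ * funNorm n φ f := by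
  rcases eq_or_ne c 0 with rfl | hc
  · simp [funNorm_zero]
  rw [funNorm, funNorm, ← rearrNorm_const_mul hφ (by simpa using hc) enorm_ne_top]
  refine rearrNorm_congr ?_
  filter_upwards [AEEqFun.coeFn_smul c f] with x hx
  rw [hx, Pi.smul_apply, enorm_smul]

theorem exists_enorm_ae_eq {G : EuclideanSpace ℝ (Fin n) → ℝ≥0∞} (hG : Measurable G)
    (hfin : ∀ᵐ x, G x ≠ ∞) : ∃ f : MeasFun n, (fun x => ‖f x‖ₑ) =ᵐ[volume] G := by
  refine ⟨AEEqFun.mk (fun x => (G x).toReal) hG.ennreal_toReal.aestronglyMeasurable, ?_⟩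
  filter_upwards [AEEqFun.coeFn_mk (fun x => (G x).toReal)
    hG.ennreal_toReal.aestronglyMeasurable, hfin] with x hx hx'
  rw [hx, Real.enorm_eq_ofReal ENNReal.toReal_nonneg, ENNReal.ofReal_toReal hx']

/-- If `G = ∞` on a set of positive measure, then `G^* = ∞` near 0. A decreasing weight that is
nonzero at `t` stays bounded below on `(0, t]`, which makes the integral infinite. -/
theorem weight_eq_zero_of_rearrNorm_lt_top {α : Type*} [MeasurableSpace α] {μ : Measure α}
    {G : α → ℝ≥0∞} (hφa : AntitoneOn φ (Ioi 0)) (hfin : rearrNorm μ φ G < ∞)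
    (hG : ¬ ∀ᵐ x ∂μ, G x ≠ ∞) {t : ℝ} (ht : 0 < t) : φ t = 0 := by
  have hpos : 0 < μ {x | G x = ∞} := by
    rw [pos_iff_ne_zero]
    simpa [ae_iff] using hG
  obtain ⟨r, hr0, hr⟩ : ∃ r : ℝ, 0 < r ∧ ENNReal.ofReal r < μ {x | G x = ∞} := by
    obtain ⟨q, hq0, hq⟩ := ENNReal.lt_iff_exists_nnreal_btwn.1 hpos
    exact ⟨q, by simpa using hq0, by simpa using hq⟩
  by_contra hne
  have hD : ∀ s ∈ Ioc 0 (min t r), decRearr μ G s = ∞ := by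
    intro s hs
    refine ENNReal.eq_top_of_forall_nnreal_le fun q => le_of_lt ?_
    rw [lt_decRearr_iff]
    refine lt_of_le_of_lt (ENNReal.ofReal_le_ofReal (hs.2.trans (min_le_right _ _)))
      (lt_of_lt_of_le hr (measure_mono fun x hx => ?_))
    rw [mem_ofPred_eq, show G x = ∞ from hx]
    exact ENNReal.coe_lt_top
  have hle : ∫⁻ s in Ioc 0 (min t r), (∞ : ℝ≥0∞) ≤ rearrNorm μ φ G := by
    refine le_trans (setLIntegral_mono' measurableSet_Ioc fun s hs => ?_)
      (lintegral_mono_set Ioc_subset_Ioi_self)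
    rw [hD s hs, ENNReal.top_mul]
    exact fun h0 => hne (le_antisymm
      (h0 ▸ hφa (mem_Ioi.2 hs.1) ht (hs.2.trans (min_le_left _ _))) zero_le)
  refine (hle.trans_lt hfin).ne ?_
  simp [ht, hr0]

/-- The radius of the ball of volume `t`. -/
noncomputable def ballRadius (n : ℕ) (t : ℝ) : ℝ :=
  (max t 0 / (volume (Metric.ball (0 : EuclideanSpace ℝ (Fin n)) 1)).toReal) ^ (n : ℝ)⁻¹

/-- The ball of volume `t`. -/
noncomputable def ballOfVolume (n : ℕ) (t : ℝ) : Set (EuclideanSpace ℝ (Fin n)) :=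
  Metric.ball 0 (ballRadius n t)

theorem unitBall_volume_pos (n : ℕ) :
    0 < (volume (Metric.ball (0 : EuclideanSpace ℝ (Fin n)) 1)).toReal :=
  ENNReal.toReal_pos (Metric.measure_ball_pos _ _ one_pos).ne' measure_ball_lt_top.ne

theorem ballRadius_nonneg (n : ℕ) (t : ℝ) : 0 ≤ ballRadius n t :=
  Real.rpow_nonneg (div_nonneg (le_max_right _ _) ENNReal.toReal_nonneg) _

theorem ballRadius_pow (hn : 0 < n) {t : ℝ} (ht : 0 ≤ t) :
    ballRadius n t ^ n = t / (volume (Metric.ball (0 : EuclideanSpace ℝ (Fin n)) 1)).toReal := by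
  rw [ballRadius, max_eq_left ht,
    Real.rpow_inv_natCast_pow (div_nonneg ht ENNReal.toReal_nonneg) hn.ne']

theorem measurableSet_ballOfVolume (n : ℕ) (t : ℝ) : MeasurableSet (ballOfVolume n t) :=
  measurableSet_ball

theorem ballOfVolume_mono (n : ℕ) : Monotone (ballOfVolume n) := fun s t hst => by
  refine Metric.ball_subset_ball (Real.rpow_le_rpow (div_nonneg (le_max_right _ _)
    ENNReal.toReal_nonneg) ?_ (by positivity))
  gcongr

theorem volume_ballOfVolume (hn : 0 < n) {t : ℝ} (ht : 0 ≤ t) :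
    volume (ballOfVolume n t) = ENNReal.ofReal t := by
  have : Nonempty (Fin n) := ⟨⟨0, hn⟩⟩
  rw [ballOfVolume, Measure.addHaar_ball _ _ (ballRadius_nonneg n t), finrank_euclideanSpace,
    Fintype.card_fin, ballRadius_pow hn ht]
  nth_rw 2 [← ENNReal.ofReal_toReal (measure_ball_lt_top (μ := volume)
    (x := (0 : EuclideanSpace ℝ (Fin n))) (r := 1)).ne]
  rw [← ENNReal.ofReal_mul (div_nonneg ht ENNReal.toReal_nonneg),
    div_mul_cancel₀ _ (unitBall_volume_pos n).ne']

/-- The class of the indicator function of a measurable set. -/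
noncomputable def indFun {n : ℕ} (A : Set (EuclideanSpace ℝ (Fin n))) (hA : MeasurableSet A) :
    MeasFun n :=
  AEEqFun.mk (A.indicator 1) (stronglyMeasurable_one.indicator hA).aestronglyMeasurable

theorem funNorm_indFun {A : Set (EuclideanSpace ℝ (Fin n))} (hA : MeasurableSet A) {t : ℝ}
    (hvol : volume A = ENNReal.ofReal t) :
    funNorm n φ (indFun A hA) = ∫⁻ s in Ioc 0 t, φ s := by
  rw [← rearrNorm_indicator_one hvol]
  refine rearrNorm_congr ?_
  filter_upwards [AEEqFun.coeFn_mk (A.indicator (1 : EuclideanSpace ℝ (Fin n) → ℝ))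
    (stronglyMeasurable_one.indicator hA).aestronglyMeasurable] with x hx
  rw [indFun, hx]
  by_cases h : x ∈ A <;> simp [h]

/-- There is a function whose rearrangement is not integrable against any nonzero decreasing
weight. -/
theorem exists_funNorm_eq_top (hn : 0 < n) :
    ∃ f : MeasFun n, ∀ φ : ℝ → ℝ≥0∞, AntitoneOn φ (Ioi 0) → ∀ t, 0 < t → φ t ≠ 0 →
      funNorm n φ f = ∞ := by
  have : Nonempty (Fin n) := ⟨⟨0, hn⟩⟩
  set κ := (volume (Metric.ball (0 : EuclideanSpace ℝ (Fin n)) 1)).toReal with hκ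
  have hκ0 : 0 < κ := unitBall_volume_pos n
  -- The function `|x|^{-2n}` has a rearrangement of size `t^{-2}`, not integrable at 0.
  let h : EuclideanSpace ℝ (Fin n) → ℝ := fun x => ((‖x‖ ^ n)⁻¹) ^ 2
  have hm : Measurable h := by fun_prop
  have hD : ∀ t, 0 < t → ENNReal.ofReal ((κ / (2 * t)) ^ 2) ≤
      decRearr volume (fun x => ‖h x‖ₑ) t := by
    intro t ht
    refine le_of_lt (lt_decRearr_iff.2 ?_)
    -- Volume `2t` instead of `t` gives the strict inequality; the origin is removed because `h 0 =
    -- 0` by the convention for inverses.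
    have h2 : ENNReal.ofReal t < volume (ballOfVolume n (2 * t) \ {0}) := by
      rw [measure_sdiff_null (measure_singleton _), volume_ballOfVolume hn (by positivity)]
      exact (ENNReal.ofReal_lt_ofReal_iff (by positivity)).2 (by linarith)
    refine h2.trans_le (measure_mono ?_)
    rintro x ⟨hx, hx0⟩
    have hx0' : 0 < ‖x‖ := norm_pos_iff.2 hx0
    have hxr : ‖x‖ < ballRadius n (2 * t) := by simpa [ballOfVolume] using hx
    have hlt : ‖x‖ ^ n < 2 * t / κ := by
      rw [← ballRadius_pow hn (by positivity)]
      exact pow_lt_pow_left₀ hxr hx0'.le hn.ne'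
    have hinv : κ / (2 * t) < (‖x‖ ^ n)⁻¹ := by
      rw [← inv_div]
      exact (inv_lt_inv₀ (by positivity) (by positivity)).2 hlt
    have : (κ / (2 * t)) ^ 2 < h x := pow_lt_pow_left₀ hinv (by positivity) two_ne_zero
    rw [mem_ofPred_eq, Real.enorm_eq_ofReal (by positivity)]
    exact (ENNReal.ofReal_lt_ofReal_iff (lt_of_le_of_lt (by positivity) this)).2 this
  refine ⟨AEEqFun.mk h hm.aestronglyMeasurable, fun φ hφ t ht hne => ?_⟩
  have hcongr : funNorm n φ (AEEqFun.mk h hm.aestronglyMeasurable) =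
      rearrNorm volume φ fun x => ‖h x‖ₑ := by
    refine rearrNorm_congr ?_
    filter_upwards [AEEqFun.coeFn_mk h hm.aestronglyMeasurable] with x hx
    rw [hx]
  rw [hcongr]
  obtain ⟨c, hc0, hc⟩ := ENNReal.lt_iff_exists_nnreal_btwn.1 (pos_iff_ne_zero.2 hne)
  have hc0' : (0 : ℝ) < c := by simpa using hc0
  refine ENNReal.eq_top_of_forall_nnreal_le fun q => ?_
  -- On `(0, ε]` the integrand is at least `(κ / 2ε)² c`, so its integral is at least `κ² c / (4ε) ≥
  -- q + 1`.
  set ε : ℝ := min t (κ ^ 2 * c / (4 * (q + 1))) with hε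
  have hε0 : 0 < ε := lt_min ht (by positivity)
  calc (q : ℝ≥0∞) ≤ ENNReal.ofReal ((κ / (2 * ε)) ^ 2 * c * ε) := by
        rw [← ENNReal.ofReal_coe_nnreal]
        refine ENNReal.ofReal_le_ofReal ?_
        have h1 : ε ≤ κ ^ 2 * c / (4 * (q + 1)) := min_le_right _ _
        rw [le_div_iff₀ (by positivity)] at h1
        have h2 : (κ / (2 * ε)) ^ 2 * c * ε = κ ^ 2 * c / (4 * ε) := by
          field_simp
          ring
        rw [h2, le_div_iff₀ (by positivity)]
        nlinarith
    _ = ∫⁻ s in Ioc 0 ε, ENNReal.ofReal ((κ / (2 * ε)) ^ 2) * c := by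
        rw [setLIntegral_const, Real.volume_Ioc, sub_zero, ENNReal.ofReal_mul (by positivity),
          ENNReal.ofReal_mul (by positivity), ENNReal.ofReal_coe_nnreal]
    _ ≤ ∫⁻ s in Ioc 0 ε, decRearr volume (fun x => ‖h x‖ₑ) s * φ s := by
        refine setLIntegral_mono' measurableSet_Ioc fun s hs => mul_le_mul' ?_ ?_
        · exact (hD ε hε0).trans (decRearr_antitone _ _ hs.2)
        · exact hc.le.trans (hφ (mem_Ioi.2 hs.1) ht (hs.2.trans (min_le_left _ _)))
    _ ≤ _ := lintegral_mono_set Ioc_subset_Ioi_self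

/-- Inclusions between the spaces `{∫ f^* φ < ∞}` are continuous. -/
theorem exists_funNorm_le_mul (hn : 0 < n) (hφ : Measurable φ) (hφa : AntitoneOn φ (Ioi 0))
    (hψ : Measurable ψ) (hψa : AntitoneOn ψ (Ioi 0))
    (h : ∀ f : MeasFun n, funNorm n ψ f < ∞ → funNorm n φ f < ∞) :
    ∃ C : ℝ≥0, ∀ f : MeasFun n, funNorm n φ f ≤ C * funNorm n ψ f := by
  by_contra! hcon
  -- If `ψ` vanishes, every `f` has finite `φ`-functional, which forces `φ = 0`. Elsewhere `ψ ≠ 0`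
  -- keeps the series below finite a.e.
  by_cases hψ0 : ∀ t, 0 < t → ψ t = 0
  · have hfin : ∀ f : MeasFun n, funNorm n φ f < ∞ := fun f => h f (by
      have : funNorm n ψ f = 0 := by
        rw [funNorm, rearrNorm_congr_weight (ψ := 0) hψ0]
        simp [rearrNorm]
      simp [this])
    obtain ⟨f₀, hf₀⟩ := exists_funNorm_eq_top hn
    have hφ0 : ∀ t, 0 < t → φ t = 0 := fun t ht => by
      by_contra hne
      exact (hfin f₀).ne (hf₀ φ hφa t ht hne)
    obtain ⟨f, hf⟩ := hcon 0
    have : funNorm n φ f = 0 := by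
      rw [funNorm, rearrNorm_congr_weight (ψ := 0) hφ0]
      simp [rearrNorm]
    simp [this] at hf
  choose f hf using fun k : ℕ => hcon (4 ^ k)
  have hψf : ∀ k, funNorm n ψ (f k) < ∞ := fun k => by
    by_contra htop
    rw [not_lt, top_le_iff] at htop
    have := hf k
    rw [htop, ENNReal.mul_top (by simp)] at this
    exact not_top_lt this
  have hφf : ∀ k, funNorm n φ (f k) ≠ ∞ := fun k => (h _ (hψf k)).ne
  have hφ0 : ∀ k, funNorm n φ (f k) ≠ 0 := fun k h0 => by
    have := hf k
    rw [h0] at this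
    exact not_lt_zero this
  -- With this normalisation the `φ`-functional of `a k |f k|` is `2^k`, while its `ψ`-functional is
  -- at most `2^{-k}` by the factor `4^k`. The sum over `k` is then finite for `ψ` and infinite for
  -- `φ`.
  set a : ℕ → ℝ≥0∞ := fun k => 2 ^ k * (funNorm n φ (f k))⁻¹ with ha
  have ha0 : ∀ k, a k ≠ 0 := fun k =>
    mul_ne_zero (pow_ne_zero _ two_ne_zero) (ENNReal.inv_ne_zero.2 (hφf k))
  have hat : ∀ k, a k ≠ ∞ := fun k =>
    ENNReal.mul_ne_top (ENNReal.pow_ne_top ENNReal.ofNat_ne_top) (ENNReal.inv_ne_top.2 (hφ0 k))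
  let H : ℕ → EuclideanSpace ℝ (Fin n) → ℝ≥0∞ := fun k x => a k * ‖f k x‖ₑ
  have hH : ∀ k, Measurable (H k) := fun k => (measurable_enorm_coe (f k)).const_mul _
  let G : EuclideanSpace ℝ (Fin n) → ℝ≥0∞ := fun x => ∑' k, H k x
  have hGm : Measurable G := Measurable.tsum hH
  have hφH : ∀ k, rearrNorm volume φ (H k) = 2 ^ k := fun k => by
    rw [rearrNorm_const_mul hφ (ha0 k) (hat k), ha]
    change 2 ^ k * (funNorm n φ (f k))⁻¹ * funNorm n φ (f k) = 2 ^ k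
    rw [mul_assoc, ENNReal.inv_mul_cancel (hφ0 k) (hφf k), mul_one]
  have hψH : ∀ k, rearrNorm volume ψ (H k) ≤ 2⁻¹ ^ k := fun k => by
    rw [rearrNorm_const_mul hψ (ha0 k) (hat k)]
    have h4 : (4 : ℝ≥0∞) ^ k = 2 ^ k * 2 ^ k := by
      rw [← mul_pow]
      norm_num
    have h1 : (4 : ℝ≥0∞) ^ k * funNorm n ψ (f k) ≤ funNorm n φ (f k) := by
      simpa using (hf k).le
    have h2 : (2 : ℝ≥0∞) ^ k * (a k * funNorm n ψ (f k)) ≤ 1 := by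
      calc (2 : ℝ≥0∞) ^ k * (a k * funNorm n ψ (f k))
          = (funNorm n φ (f k))⁻¹ * (4 ^ k * funNorm n ψ (f k)) := by rw [ha, h4]; ring
        _ ≤ (funNorm n φ (f k))⁻¹ * funNorm n φ (f k) := by gcongr
        _ ≤ 1 := ENNReal.inv_mul_le_one _
    rw [← ENNReal.inv_pow, ENNReal.le_inv_iff_mul_le, mul_comm]
    exact h2
  have hψG : rearrNorm volume ψ G < ∞ := by
    refine (rearrNorm_tsum_le hH hψ hψa).trans_lt
      ((ENNReal.tsum_le_tsum hψH).trans_lt ?_)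
    rw [ENNReal.tsum_geometric, ENNReal.one_sub_inv_two, inv_inv]
    exact ENNReal.ofNat_lt_top
  have hGfin : ∀ᵐ x, G x ≠ ∞ := by
    by_contra hne
    exact hψ0 fun t ht => weight_eq_zero_of_rearrNorm_lt_top hψa hψG hne ht
  obtain ⟨g, hg⟩ := exists_enorm_ae_eq hGm hGfin
  have h1 : funNorm n ψ g < ∞ := by
    rw [funNorm, rearrNorm_congr hg]
    exact hψG
  refine (h g h1).ne ?_
  rw [funNorm, rearrNorm_congr hg]
  refine ENNReal.eq_top_of_forall_nnreal_le fun q => ?_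
  obtain ⟨k, hk⟩ := exists_nat_ge q
  calc (q : ℝ≥0∞) ≤ (k : ℝ≥0∞) := by exact_mod_cast hk
    _ ≤ 2 ^ k := by exact_mod_cast (Nat.lt_two_pow_self).le
    _ = rearrNorm volume φ (H k) := (hφH k).symm
    _ ≤ rearrNorm volume φ G :=
        rearrNorm_mono (Eventually.of_forall fun x => ENNReal.le_tsum k)

end FunNorm

/-! ### Dyadic telescoping of integrals against `dr/r` -/

section Dyadic

theorem intervalIntegrable_div_self {g : ℝ → ℝ}
    (hg : ∀ a b, 0 < a → 0 < b → IntervalIntegrable g volume a b) {a b : ℝ} (ha : 0 < a)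
    (hb : 0 < b) : IntervalIntegrable (fun r => g r / r) volume a b := by
  simp only [div_eq_mul_inv]
  refine (hg a b ha hb).mul_continuousOn (continuousOn_inv₀.mono fun r hr => ?_)
  have : 0 < r := lt_of_lt_of_le (lt_min ha hb) hr.1
  exact this.ne'

theorem intervalIntegrable_comp_two_mul_div_self {g : ℝ → ℝ}
    (hg : ∀ a b, 0 < a → 0 < b → IntervalIntegrable g volume a b) {a b : ℝ} (ha : 0 < a)
    (hb : 0 < b) : IntervalIntegrable (fun r => g (2 * r) / r) volume a b := by
  have h := intervalIntegrable_div_self hg (mul_pos two_pos ha) (mul_pos two_pos hb)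
  have h2 := (h.comp_mul_left (c := 2)).const_mul 2
  simp only [mul_div_cancel_left₀ _ (two_ne_zero' ℝ)] at h2
  refine h2.congr fun r hr => ?_
  rcases eq_or_ne r 0 with rfl | hr0
  · simp
  · field_simp

/-- Since `dr/r` is dilation invariant, the term `g (2 * r)` integrates over `[2a, 2b]`, and the
overlap cancels as in a Frullani integral. -/
theorem integral_sub_comp_two_mul_div {g : ℝ → ℝ}
    (hg : ∀ a b, 0 < a → 0 < b → IntervalIntegrable g volume a b) {a b : ℝ} (ha : 0 < a)
    (hb : 0 < b) :
    ∫ r in a..b, (g r - g (2 * r)) / r =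
      (∫ r in a..2 * a, g r / r) - ∫ r in b..2 * b, g r / r := by
  have hI := fun {x y : ℝ} (hx : 0 < x) (hy : 0 < y) => intervalIntegrable_div_self hg hx hy
  have h2a : 0 < 2 * a := by positivity
  have h2b : 0 < 2 * b := by positivity
  have h1 : ∫ r in a..b, g (2 * r) / r = ∫ r in 2 * a..2 * b, g r / r := by
    have h := intervalIntegral.integral_comp_mul_left (fun r => g r / r) (two_ne_zero' ℝ)
      (a := a) (b := b)
    rw [smul_eq_mul, eq_inv_mul_iff_mul_eq₀ two_ne_zero] at h
    rw [← h, ← intervalIntegral.integral_const_mul]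
    refine intervalIntegral.integral_congr fun r _ => ?_
    rcases eq_or_ne r 0 with rfl | hr0
    · simp
    · field_simp
  simp only [sub_div]
  rw [intervalIntegral.integral_sub (hI ha hb) (intervalIntegrable_comp_two_mul_div_self hg ha hb),
    h1, intervalIntegral.integral_interval_sub_interval_comm (hI ha hb) (hI h2a h2b) (hI ha h2a)]

theorem integral_const_div_two_mul (m : ℝ) {a : ℝ} (ha : 0 < a) :
    ∫ r in a..2 * a, m / r = Real.log 2 * m := by
  simp only [div_eq_mul_inv]
  rw [intervalIntegral.integral_const_mul, integral_inv_of_pos ha (by positivity),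
    mul_div_cancel_right₀ _ ha.ne', mul_comm]

theorem integral_div_two_mul_le {g : ℝ → ℝ}
    (hg : ∀ a b, 0 < a → 0 < b → IntervalIntegrable g volume a b) {a m : ℝ} (ha : 0 < a)
    (h : ∀ r ∈ Icc a (2 * a), g r ≤ m) : ∫ r in a..2 * a, g r / r ≤ Real.log 2 * m := by
  have h2a : 0 < 2 * a := by positivity
  rw [← integral_const_div_two_mul m ha]
  refine intervalIntegral.integral_mono_on (by linarith) (intervalIntegrable_div_self hg ha h2a)
    (intervalIntegrable_div_self (fun _ _ _ _ => intervalIntegrable_const) ha h2a) fun r hr => ?_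
  have : 0 < r := lt_of_lt_of_le ha hr.1
  gcongr
  exact h r hr

theorem le_integral_div_two_mul {g : ℝ → ℝ}
    (hg : ∀ a b, 0 < a → 0 < b → IntervalIntegrable g volume a b) {a m : ℝ} (ha : 0 < a)
    (h : ∀ r ∈ Icc a (2 * a), m ≤ g r) : Real.log 2 * m ≤ ∫ r in a..2 * a, g r / r := by
  have h2a : 0 < 2 * a := by positivity
  rw [← integral_const_div_two_mul m ha]
  refine intervalIntegral.integral_mono_on (by linarith)
    (intervalIntegrable_div_self (fun _ _ _ _ => intervalIntegrable_const) ha h2a)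
    (intervalIntegrable_div_self hg ha h2a) fun r hr => ?_
  have : 0 < r := lt_of_lt_of_le ha hr.1
  gcongr
  exact h r hr

theorem log_two_le_one : Real.log 2 ≤ 1 := by
  have := Real.log_two_lt_d9
  linarith

theorem half_le_log_two : 1 / 2 ≤ Real.log 2 := by
  have := Real.log_two_gt_d9
  linarith

theorem lintegral_Ioi_eq_two_mul {G : ℝ → ℝ≥0∞} (hG : Measurable G) :
    ∫⁻ t in Ioi 0, G t = 2 * ∫⁻ t in Ioi 0, G (2 * t) := by
  have hI := hG.indicator (measurableSet_Ioi (a := (0 : ℝ)))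
  have h := Real.smul_map_volume_mul_left (two_ne_zero' ℝ)
  have key : ∫⁻ t, (Ioi 0).indicator G t = 2 * ∫⁻ t, (Ioi 0).indicator G (2 * t) := by
    conv_lhs => rw [← h]
    rw [lintegral_smul_measure, lintegral_map hI (measurable_const_mul 2)]
    simp
  rw [← lintegral_indicator measurableSet_Ioi, key, ← lintegral_indicator measurableSet_Ioi]
  congr 2
  ext t
  by_cases ht : 0 < t
  · rw [indicator_of_mem (mem_Ioi.2 ht), indicator_of_mem (mem_Ioi.2 (by positivity))]
  · rw [indicator_of_notMem (by simpa using ht), indicator_of_notMem (by simpa using ht)]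

end Dyadic

/-! ### Decreasing weights and their dyadic differences -/

section DecreasingWeight

variable {w : ℝ → ℝ} {n : ℕ}

theorem tendsto_valueAtInfty (hw : IsWeight w) (ha : AntitoneOn w (Ioi 0)) :
    Tendsto w atTop (𝓝 (valueAtInfty w)) := by
  refine tendsto_nhds_limUnder ?_
  have hanti : Antitone fun t : ℝ => w (max t 1) := fun s t hst =>
    ha (mem_Ioi.2 (lt_max_of_lt_right one_pos)) (mem_Ioi.2 (lt_max_of_lt_right one_pos))
      (max_le_max_right _ hst)
  have hbdd : BddBelow (range fun t : ℝ => w (max t 1)) := by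
    refine ⟨0, ?_⟩
    rintro _ ⟨t, rfl⟩
    exact hw.nonneg _ (lt_max_of_lt_right one_pos)
  refine ⟨_, (tendsto_atTop_ciInf hanti hbdd).congr' ?_⟩
  filter_upwards [eventually_ge_atTop 1] with t ht
  rw [max_eq_left ht]

theorem valueAtInfty_le (hw : IsWeight w) (ha : AntitoneOn w (Ioi 0)) {t : ℝ} (ht : 0 < t) :
    valueAtInfty w ≤ w t := by
  refine le_of_tendsto (tendsto_valueAtInfty hw ha) ?_
  filter_upwards [eventually_ge_atTop t] with r hr
  exact ha ht (mem_Ioi.2 (ht.trans_le hr)) hr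

theorem valueAtInfty_nonneg (hw : IsWeight w) (ha : AntitoneOn w (Ioi 0)) :
    0 ≤ valueAtInfty w := by
  refine ge_of_tendsto (tendsto_valueAtInfty hw ha) ?_
  filter_upwards [eventually_gt_atTop 0] with r hr using hw.nonneg r hr

/-- The dyadic difference of a decreasing weight. -/
def dyadicDiff (w : ℝ → ℝ) (t : ℝ) : ℝ := w t - w (2 * t)

theorem dyadicDiff_nonneg (ha : AntitoneOn w (Ioi 0)) {t : ℝ} (ht : 0 < t) :
    0 ≤ dyadicDiff w t :=
  sub_nonneg.2 (ha ht (mem_Ioi.2 (by positivity)) (by linarith))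

theorem IsWeight.dyadicDiff (hw : IsWeight w) (ha : AntitoneOn w (Ioi 0)) :
    IsWeight (dyadicDiff w) := by
  have hm : Measurable fun t : Ioi (0 : ℝ) => _root_.dyadicDiff w t := by
    have h2 : Measurable fun t : Ioi (0 : ℝ) =>
        (⟨2 * t, mem_Ioi.2 (mul_pos two_pos t.2)⟩ : Ioi (0 : ℝ)) :=
      Measurable.subtype_mk (measurable_subtype_coe.const_mul 2)
    exact hw.measurable.sub (hw.measurable.comp h2)
  refine ⟨fun t ht => dyadicDiff_nonneg ha ht, hm, fun t ht => ?_⟩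
  have hm' : AEMeasurable (_root_.dyadicDiff w) (volume.restrict (Ioi 0)) :=
    (aemeasurable_restrict_iff_comap_subtype measurableSet_Ioi).2 hm.aemeasurable
  refine (hw.integrableOn t ht).mono'
    (hm'.mono_measure (Measure.restrict_mono Ioc_subset_Ioi_self le_rfl)).aestronglyMeasurable ?_
  filter_upwards [ae_restrict_mem measurableSet_Ioc] with s hs
  rw [Real.norm_of_nonneg (dyadicDiff_nonneg ha hs.1)]
  exact sub_le_self _ (hw.nonneg _ (mul_pos two_pos hs.1))

theorem intervalIntegrable_of_antitoneOn (ha : AntitoneOn w (Ioi 0)) (a b : ℝ) (ha0 : 0 < a)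
    (hb : 0 < b) : IntervalIntegrable w volume a b :=
  (ha.mono fun _ hr => mem_Ioi.2 (lt_of_lt_of_le (lt_min ha0 hb) hr.1)).intervalIntegrable

theorem setLIntegral_dyadicDiff (ha : AntitoneOn w (Ioi 0)) {s T : ℝ} (hs : 0 < s)
    (hT : s ≤ T) :
    ∫⁻ t in Ioc s T, (ENNReal.ofReal t)⁻¹ * weightFun (dyadicDiff w) t =
      ENNReal.ofReal ((∫ r in s..2 * s, w r / r) - ∫ r in T..2 * T, w r / r) := by
  have hg := intervalIntegrable_of_antitoneOn ha
  have hT0 := hs.trans_le hT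
  have hint : IntervalIntegrable (fun r => (w r - w (2 * r)) / r) volume s T := by
    simp only [sub_div]
    exact (intervalIntegrable_div_self hg hs hT0).sub
      (intervalIntegrable_comp_two_mul_div_self hg hs hT0)
  rw [← integral_sub_comp_two_mul_div hg hs hT0,
    intervalIntegral.integral_of_le hT, ofReal_integral_eq_lintegral_ofReal hint.1]
  · refine setLIntegral_congr_fun measurableSet_Ioc fun t ht => ?_
    have ht0 : 0 < t := hs.trans ht.1
    simp only [weightFun_of_pos _ ht0, ← ENNReal.ofReal_inv_of_pos ht0]
    rw [← ENNReal.ofReal_mul (by positivity), div_eq_inv_mul, dyadicDiff]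
  · filter_upwards [ae_restrict_mem measurableSet_Ioc] with t ht
    have ht0 : 0 < t := hs.trans ht.1
    exact div_nonneg (dyadicDiff_nonneg ha ht0) ht0.le

/-- By telescoping up to `T`, the kernel is a limit of differences of averages over `[s, 2s]` and
`[T, 2T]`, each at most `log 2 · (w(s) - w(∞)) ≤ w(s) - w(∞)`. -/
theorem gammaKernel_dyadicDiff_add_le (hw : IsWeight w) (ha : AntitoneOn w (Ioi 0)) {s : ℝ}
    (hs : 0 < s) :
    gammaKernel (dyadicDiff w) s + ENNReal.ofReal (valueAtInfty w) ≤ weightFun w s := by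
  have hg := intervalIntegrable_of_antitoneOn ha
  set c := valueAtInfty w with hc
  have hcs : c ≤ w s := valueAtInfty_le hw ha hs
  have hc0 : 0 ≤ c := valueAtInfty_nonneg hw ha
  have hU : Ioi s = ⋃ k : ℕ, Ioc s (s + k) := by
    ext r
    simp only [mem_Ioi, mem_iUnion, mem_Ioc]
    refine ⟨fun hr => ?_, fun ⟨k, hk⟩ => hk.1⟩
    obtain ⟨k, hk⟩ := exists_nat_ge (r - s)
    exact ⟨k, hr, by linarith⟩
  have hm : Monotone fun k : ℕ => Ioc s (s + k) := fun i j hij =>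
    Ioc_subset_Ioc_right (by have : (i : ℝ) ≤ j := by exact_mod_cast hij
                             linarith)
  have hle : gammaKernel (dyadicDiff w) s ≤ ENNReal.ofReal (w s - c) := by
    rw [gammaKernel, setLIntegral_congr Ioi_ae_eq_Ici.symm, hU,
      setLIntegral_iUnion_of_directed _ hm.directed_le]
    refine iSup_le fun k => ?_
    have hk : s ≤ s + k := by simp
    rw [setLIntegral_dyadicDiff ha hs hk]
    refine ENNReal.ofReal_le_ofReal ?_
    have h1 := integral_div_two_mul_le hg hs (m := w s) fun r hr =>
      ha hs (mem_Ioi.2 (hs.trans_le hr.1)) hr.1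
    have h2 := le_integral_div_two_mul hg (hs.trans_le hk) (m := c) fun r hr =>
      valueAtInfty_le hw ha ((hs.trans_le hk).trans_le hr.1)
    nlinarith [log_two_le_one]
  rw [weightFun_of_pos w hs]
  calc _ ≤ ENNReal.ofReal (w s - c) + ENNReal.ofReal c := by gcongr
    _ = ENNReal.ofReal (w s) := by
        rw [← ENNReal.ofReal_add (by linarith) hc0, sub_add_cancel]

/-- On `[s, 2s]` the weight is at least `w(2s)`, so the kernel is at least `log 2 · (w(2s) - w(∞))`;
the factor 2 comes from `log 2 ≥ 1/2`. -/
theorem weightFun_two_mul_le (hw : IsWeight w) (ha : AntitoneOn w (Ioi 0)) {s : ℝ}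
    (hs : 0 < s) :
    weightFun w (2 * s) ≤
      2 * (gammaKernel (dyadicDiff w) s + ENNReal.ofReal (valueAtInfty w)) := by
  have hg := intervalIntegrable_of_antitoneOn ha
  set c := valueAtInfty w with hc
  have hc0 : 0 ≤ c := valueAtInfty_nonneg hw ha
  have h2s : 0 < 2 * s := by positivity
  have hcs : c ≤ w (2 * s) := valueAtInfty_le hw ha h2s
  have hle : ENNReal.ofReal (Real.log 2 * (w (2 * s) - c)) ≤ gammaKernel (dyadicDiff w) s := by
    have htend : Tendsto (fun T => ENNReal.ofReal (Real.log 2 * (w (2 * s) - w T))) atTop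
        (𝓝 (ENNReal.ofReal (Real.log 2 * (w (2 * s) - c)))) :=
      ENNReal.tendsto_ofReal ((tendsto_const_nhds.sub (tendsto_valueAtInfty hw ha)).const_mul _)
    refine le_of_tendsto htend ?_
    filter_upwards [eventually_ge_atTop s] with T hT
    have hT0 := hs.trans_le hT
    calc ENNReal.ofReal (Real.log 2 * (w (2 * s) - w T))
        ≤ ENNReal.ofReal ((∫ r in s..2 * s, w r / r) - ∫ r in T..2 * T, w r / r) := by
          refine ENNReal.ofReal_le_ofReal ?_
          have h1 := integral_div_two_mul_le hg hT0 (m := w T) fun r hr =>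
            ha hT0 (mem_Ioi.2 (hT0.trans_le hr.1)) hr.1
          have h2 := le_integral_div_two_mul hg hs (m := w (2 * s)) fun r hr =>
            ha (mem_Ioi.2 (hs.trans_le hr.1)) h2s hr.2
          linarith
      _ = _ := (setLIntegral_dyadicDiff ha hs hT).symm
      _ ≤ _ := lintegral_mono_set (Ioc_subset_Ioi_self.trans Ioi_subset_Ici_self)
  rw [weightFun_of_pos w h2s]
  calc ENNReal.ofReal (w (2 * s))
      ≤ ENNReal.ofReal (2 * (Real.log 2 * (w (2 * s) - c) + c)) := by
        refine ENNReal.ofReal_le_ofReal ?_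
        nlinarith [half_le_log_two]
    _ = 2 * (ENNReal.ofReal (Real.log 2 * (w (2 * s) - c)) + ENNReal.ofReal c) := by
        rw [ENNReal.ofReal_mul two_pos.le, ENNReal.ofReal_add
          (mul_nonneg (Real.log_nonneg one_le_two) (by linarith)) hc0, ENNReal.ofReal_ofNat]
    _ ≤ _ := by gcongr

theorem funNorm_gammaKernel_add_eq (v : ℝ → ℝ) (c : ℝ≥0∞) (f : MeasFun n) :
    funNorm n (fun t => gammaKernel v t + c) f =
      funNorm n (gammaKernel v) f + c * l1Norm n f := by
  rw [l1Norm_eq_funNorm, funNorm, funNorm, funNorm,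
    ← rearrNorm_const_mul_weight measurable_one, ← rearrNorm_add_weight (measurable_gammaKernel v)]
  simp [Pi.add_def]

theorem gammaNorm_dyadicDiff_add_le (hw : IsWeight w) (ha : AntitoneOn w (Ioi 0))
    (f : MeasFun n) :
    gammaNorm n (dyadicDiff w) f + ENNReal.ofReal (valueAtInfty w) * l1Norm n f ≤
      lambdaNorm n w f := by
  rw [gammaNorm_eq_funNorm (hw.dyadicDiff ha), ← funNorm_gammaKernel_add_eq,
    lambdaNorm_eq_funNorm]
  exact rearrNorm_mono_weight fun t ht => gammaKernel_dyadicDiff_add_le hw ha ht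

theorem lambdaNorm_le_gammaNorm_dyadicDiff_add (hw : IsWeight w) (ha : AntitoneOn w (Ioi 0))
    (f : MeasFun n) :
    lambdaNorm n w f ≤ 4 * (gammaNorm n (dyadicDiff w) f +
      ENNReal.ofReal (valueAtInfty w) * l1Norm n f) := by
  rw [gammaNorm_eq_funNorm (hw.dyadicDiff ha), ← funNorm_gammaKernel_add_eq,
    lambdaNorm_eq_funNorm]
  have hD : Measurable (decRearr volume fun x => ‖f x‖ₑ) := measurable_decRearr _ _
  have hk : Measurable fun t => gammaKernel (dyadicDiff w) t + ENNReal.ofReal (valueAtInfty w) :=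
    (measurable_gammaKernel _).add measurable_const
  -- The substitution `t ↦ 2t` costs one factor 2, after which `f^*(2t) ≤ f^*(t)`; the bound on
  -- `w(2t)` costs the other.
  rw [funNorm, rearrNorm, lintegral_Ioi_eq_two_mul
      (G := fun t => decRearr volume (fun x => ‖f x‖ₑ) t * weightFun w t)
      (hD.mul hw.measurable_weightFun),
    show (4 : ℝ≥0∞) = 2 * 2 by norm_num, mul_assoc, funNorm, ← rearrNorm_const_mul_weight hk]
  gcongr 2 * ?_
  refine setLIntegral_mono' measurableSet_Ioi fun t ht => mul_le_mul' ?_ ?_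
  · exact decRearr_antitone _ _ (by linarith [mem_Ioi.1 ht])
  · exact weightFun_two_mul_le hw ha ht

end DecreasingWeight

/-! ### Testing on balls, and norm equivalence from equality of sets -/

section Equivalence

variable {n : ℕ} {w v : ℝ → ℝ}

theorem NormEquiv.of_le {N₁ N₂ : MeasFun n → ℝ≥0∞} {C₁ C₂ : ℝ≥0} (h₁ : ∀ f, N₁ f ≤ C₁ * N₂ f)
    (h₂ : ∀ f, N₂ f ≤ C₂ * N₁ f) : NormEquiv N₁ N₂ :=
  ⟨max C₁ C₂, fun f => ⟨(h₁ f).trans (by gcongr; exact le_max_left _ _),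
    (h₂ f).trans (by gcongr; exact le_max_right _ _)⟩⟩

theorem NormEquiv.symm {N₁ N₂ : MeasFun n → ℝ≥0∞} (h : NormEquiv N₁ N₂) : NormEquiv N₂ N₁ :=
  let ⟨C, hC⟩ := h
  ⟨C, fun f => (hC f).symm⟩

theorem NormEquiv.trans {N₁ N₂ N₃ : MeasFun n → ℝ≥0∞} (h₁ : NormEquiv N₁ N₂)
    (h₂ : NormEquiv N₂ N₃) : NormEquiv N₁ N₃ := by
  obtain ⟨C, hC⟩ := h₁
  obtain ⟨D, hD⟩ := h₂
  refine ⟨C * D, fun f => ⟨?_, ?_⟩⟩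
  · rw [ENNReal.coe_mul, mul_assoc]
    exact (hC f).1.trans (by gcongr; exact (hD f).1)
  · rw [ENNReal.coe_mul, mul_comm (C : ℝ≥0∞), mul_assoc]
    exact (hD f).2.trans (by gcongr; exact (hC f).2)

theorem IsWeight.setLIntegral_weightFun_lt_top (hw : IsWeight w) {t : ℝ} (ht : 0 < t) :
    ∫⁻ s in Ioc 0 t, weightFun w s < ∞ := by
  have h := (hw.integrableOn t ht).lintegral_lt_top
  rwa [setLIntegral_congr_fun measurableSet_Ioc fun s hs => weightFun_of_pos w hs.1]

theorem primitive_le_of_funNorm_le (hn : 0 < n) {φ ψ : ℝ → ℝ≥0∞} {C : ℝ≥0∞}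
    (h : ∀ f : MeasFun n, funNorm n φ f ≤ C * funNorm n ψ f) {t : ℝ} (ht : 0 ≤ t) :
    ∫⁻ s in Ioc 0 t, φ s ≤ C * ∫⁻ s in Ioc 0 t, ψ s := by
  have hA := measurableSet_ballOfVolume n t
  have hv := volume_ballOfVolume hn ht
  rw [← funNorm_indFun hA hv, ← funNorm_indFun hA hv]
  exact h _

theorem ofReal_mul_le_setLIntegral {φ : ℝ → ℝ≥0∞} (hφ : AntitoneOn φ (Ioi 0)) {t : ℝ}
    (ht : 0 < t) : ENNReal.ofReal t * φ t ≤ ∫⁻ s in Ioc 0 t, φ s := by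
  calc ENNReal.ofReal t * φ t = ∫⁻ _ in Ioc 0 t, φ t := by simp [mul_comm]
    _ ≤ _ := setLIntegral_mono' measurableSet_Ioc fun s hs => hφ (mem_Ioi.2 hs.1) ht hs.2

/-- Once `C φ(T) < 1/2`, the bound would give `t ≤ A + t/2` for all `t ≥ T`, with `A = C ∫₀ᵀ φ`;
this fails for `t > 2A`. -/
theorem not_forall_ofReal_le_primitive {φ : ℝ → ℝ≥0∞} (hφ : AntitoneOn φ (Ioi 0))
    (hlim : Tendsto φ atTop (𝓝 0)) (hfin : ∀ t, 0 < t → ∫⁻ s in Ioc 0 t, φ s < ∞) (C : ℝ≥0) :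
    ¬ ∀ t, 0 < t → ENNReal.ofReal t ≤ C * ∫⁻ s in Ioc 0 t, φ s := by
  intro h
  have hlim' : Tendsto (fun t => C * φ t) atTop (𝓝 0) := by
    simpa using ENNReal.Tendsto.const_mul hlim (Or.inr (ENNReal.coe_ne_top (r := C)))
  obtain ⟨T, hT, hT0⟩ := ((hlim'.eventually_lt_const
    (show (0 : ℝ≥0∞) < 2⁻¹ by simp)).and (eventually_gt_atTop 0)).exists
  have hA : C * ∫⁻ s in Ioc 0 T, φ s ≠ ∞ :=
    ENNReal.mul_ne_top ENNReal.coe_ne_top (hfin T hT0).ne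
  set A := (C * ∫⁻ s in Ioc 0 T, φ s).toReal with hAdef
  have hA0 : 0 ≤ A := ENNReal.toReal_nonneg
  have key : ∀ t, T ≤ t → t ≤ A + t / 2 := by
    intro t ht
    have ht0 : 0 < t := hT0.trans_le ht
    have h1 : ENNReal.ofReal t ≤ ENNReal.ofReal (A + t / 2) := by
      calc ENNReal.ofReal t ≤ C * ∫⁻ s in Ioc 0 t, φ s := h t ht0
        _ ≤ C * ((∫⁻ s in Ioc 0 T, φ s) + ∫⁻ s in Ioc T t, φ s) := by
            rw [← Ioc_union_Ioc_eq_Ioc hT0.le ht]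
            gcongr
            exact lintegral_union_le _ _ _
        _ ≤ C * ((∫⁻ s in Ioc 0 T, φ s) + ∫⁻ _ in Ioc T t, φ T) := by
            gcongr C * (_ + ?_)
            exact setLIntegral_mono' measurableSet_Ioc fun s hs =>
              hφ hT0 (mem_Ioi.2 (hT0.trans hs.1)) hs.1.le
        _ = C * (∫⁻ s in Ioc 0 T, φ s) + C * φ T * ENNReal.ofReal (t - T) := by
            rw [setLIntegral_const, Real.volume_Ioc]
            ring
        _ ≤ ENNReal.ofReal A + 2⁻¹ * ENNReal.ofReal t := by
            rw [hAdef, ENNReal.ofReal_toReal hA]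
            gcongr
            linarith
        _ = ENNReal.ofReal (A + t / 2) := by
            rw [ENNReal.ofReal_add hA0 (by positivity), div_eq_inv_mul,
              ENNReal.ofReal_mul (by positivity), ENNReal.ofReal_inv_of_pos two_pos,
              ENNReal.ofReal_ofNat]
    exact (ENNReal.ofReal_le_ofReal_iff (by positivity)).1 h1
  have := key (max T (2 * A + 1)) (le_max_left _ _)
  have h2 := le_max_right T (2 * A + 1)
  linarith

/-- The kernel is the mass of `[r, ∞)` under `v dt/t`; continuity from above applies once one tail
is finite. -/
theorem tendsto_gammaKernel {s : ℝ} (hfin : gammaKernel v s < ∞) :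
    Tendsto (gammaKernel v) atTop (𝓝 0) := by
  set k : ℝ → ℝ≥0∞ := fun t => (ENNReal.ofReal t)⁻¹ * weightFun v t with hk
  have hg : ∀ r, gammaKernel v r = (volume.withDensity k) (Ici r) := fun r =>
    (withDensity_apply _ measurableSet_Ici).symm
  have h := tendsto_measure_iInter_atTop (μ := volume.withDensity k) (s := fun r : ℝ => Ici r)
    (fun r => measurableSet_Ici.nullMeasurableSet) (fun a b hab => Ici_subset_Ici.2 hab)
    ⟨s, by rw [← hg]; exact hfin.ne⟩
  have hempty : ⋂ r : ℝ, Ici r = ∅ := by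
    refine eq_empty_of_forall_notMem fun x hx => ?_
    have := mem_iInter.1 hx (x + 1)
    linarith [mem_Ici.1 this]
  rw [hempty, measure_empty] at h
  exact h.congr fun r => (hg r).symm

theorem not_l1Norm_le_gammaNorm (hn : 0 < n) (hv : IsWeight v) {C : ℝ≥0}
    (hfin : ∀ t, 0 < t → ∫⁻ s in Ioc 0 t, gammaKernel v s < ∞) :
    ¬ ∀ f : MeasFun n, l1Norm n f ≤ C * gammaNorm n v f := by
  intro h
  simp only [l1Norm_eq_funNorm, gammaNorm_eq_funNorm hv] at h
  have hanti := (gammaKernel_antitone v).antitoneOn (Ioi 0)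
  have h1 : gammaKernel v 1 < ∞ := by
    have := (ofReal_mul_le_setLIntegral hanti one_pos).trans_lt (hfin 1 one_pos)
    simpa using this
  refine not_forall_ofReal_le_primitive hanti (tendsto_gammaKernel h1) hfin C fun t ht => ?_
  simpa using primitive_le_of_funNorm_le hn h ht.le

theorem valueAtInfty_pos_of_l1Norm_le (hn : 0 < n) (hw : IsWeight w) (ha : AntitoneOn w (Ioi 0))
    {C : ℝ≥0} (h : ∀ f : MeasFun n, l1Norm n f ≤ C * lambdaNorm n w f) : 0 < valueAtInfty w := by
  refine (valueAtInfty_nonneg hw ha).lt_of_ne fun h0 => ?_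
  simp only [l1Norm_eq_funNorm, lambdaNorm_eq_funNorm] at h
  have hlim : Tendsto (weightFun w) atTop (𝓝 0) := by
    have := ENNReal.tendsto_ofReal (tendsto_valueAtInfty hw ha)
    rw [← h0, ENNReal.ofReal_zero] at this
    refine this.congr' ?_
    filter_upwards [eventually_gt_atTop 0] with t ht using (weightFun_of_pos w ht).symm
  refine not_forall_ofReal_le_primitive (antitoneOn_weightFun ha) hlim
    (fun t ht => hw.setLIntegral_weightFun_lt_top ht) C fun t ht => ?_
  simpa using primitive_le_of_funNorm_le hn h ht.le

theorem l1Norm_le_of_valueAtInfty_pos (hw : IsWeight w) (ha : AntitoneOn w (Ioi 0))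
    (hc : 0 < valueAtInfty w) :
    ∃ C : ℝ≥0, ∀ f : MeasFun n, l1Norm n f ≤ C * lambdaNorm n w f := by
  refine ⟨(valueAtInfty w).toNNReal⁻¹, fun f => ?_⟩
  have h : ENNReal.ofReal (valueAtInfty w) * l1Norm n f ≤ lambdaNorm n w f :=
    le_add_self.trans (gammaNorm_dyadicDiff_add_le hw ha f)
  have hne : (valueAtInfty w).toNNReal ≠ 0 := by simpa using hc
  rw [ENNReal.coe_inv hne]
  change _ ≤ (ENNReal.ofReal (valueAtInfty w))⁻¹ * _
  rw [← ENNReal.mul_le_iff_le_inv (by simpa using hc) ENNReal.ofReal_ne_top]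
  exact h

/-- Testing on balls gives `t w(t) ≤ ∫₀ᵗ w ≤ C t`, the first inequality by monotonicity. -/
theorem memLp_top_of_lambdaNorm_le (hn : 0 < n) (hw : IsWeight w) (ha : AntitoneOn w (Ioi 0))
    {C : ℝ≥0} (h : ∀ f : MeasFun n, lambdaNorm n w f ≤ C * l1Norm n f) :
    MemLp w ∞ (volume.restrict (Ioi 0)) := by
  simp only [l1Norm_eq_funNorm, lambdaNorm_eq_funNorm] at h
  have hm : AEMeasurable w (volume.restrict (Ioi 0)) :=
    (aemeasurable_restrict_iff_comap_subtype measurableSet_Ioi).2 hw.measurable.aemeasurable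
  refine memLp_top_of_bound hm.aestronglyMeasurable C ?_
  filter_upwards [ae_restrict_mem measurableSet_Ioi] with t ht
  have ht0 : 0 < t := ht
  rw [Real.norm_of_nonneg (hw.nonneg t ht0)]
  have h1 := (ofReal_mul_le_setLIntegral (antitoneOn_weightFun ha) ht0).trans
    (primitive_le_of_funNorm_le hn h ht0.le)
  rw [weightFun_of_pos w ht0] at h1
  have h2 : ENNReal.ofReal (t * w t) ≤ ENNReal.ofReal (C * t) := by
    rw [ENNReal.ofReal_mul ht0.le, ENNReal.ofReal_mul C.coe_nonneg, ENNReal.ofReal_coe_nnreal]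
    simpa using h1
  have h3 := (ENNReal.ofReal_le_ofReal_iff (by positivity)).1 h2
  rw [mul_comm] at h3
  exact le_of_mul_le_mul_right h3 ht0

theorem lambdaNorm_le_of_memLp_top (hw : IsWeight w)
    (h : MemLp w ∞ (volume.restrict (Ioi 0))) :
    ∃ C : ℝ≥0, ∀ f : MeasFun n, lambdaNorm n w f ≤ C * l1Norm n f := by
  have hM : eLpNormEssSup w (volume.restrict (Ioi 0)) ≠ ∞ := by
    rw [← eLpNorm_exponent_top]
    exact h.eLpNorm_lt_top.ne
  lift eLpNormEssSup w (volume.restrict (Ioi 0)) to ℝ≥0 using hM with M hMe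
  refine ⟨M, fun f => ?_⟩
  rw [l1Norm_eq_funNorm, lambdaNorm_eq_funNorm, funNorm, funNorm,
    ← rearrNorm_const_mul_weight measurable_one]
  refine lintegral_mono_ae ?_
  filter_upwards [ae_le_eLpNormEssSup (f := w) (μ := volume.restrict (Ioi 0)),
    ae_restrict_mem measurableSet_Ioi] with t ht ht0
  rw [← hMe, Real.enorm_eq_ofReal (hw.nonneg t ht0)] at ht
  rw [weightFun_of_pos w ht0]
  gcongr
  simpa using ht

/-- The functionals `∫ f^* φ` with `φ` decreasing. -/
def IsDecreasingFunctional (N : MeasFun n → ℝ≥0∞) : Prop :=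
  ∃ φ : ℝ → ℝ≥0∞, Measurable φ ∧ AntitoneOn φ (Ioi 0) ∧ ∀ f, N f = funNorm n φ f

theorem isDecreasingFunctional_lambdaNorm (hw : IsWeight w) (ha : AntitoneOn w (Ioi 0)) :
    IsDecreasingFunctional (lambdaNorm n w) :=
  ⟨_, hw.measurable_weightFun, antitoneOn_weightFun ha, lambdaNorm_eq_funNorm w⟩

theorem isDecreasingFunctional_gammaNorm (hv : IsWeight v) :
    IsDecreasingFunctional (gammaNorm n v) :=
  ⟨_, measurable_gammaKernel v, (gammaKernel_antitone v).antitoneOn _, gammaNorm_eq_funNorm hv⟩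

theorem isDecreasingFunctional_l1Norm : IsDecreasingFunctional (l1Norm n) :=
  ⟨_, measurable_one, antitoneOn_const, l1Norm_eq_funNorm⟩

theorem IsDecreasingFunctional.add {N M : MeasFun n → ℝ≥0∞} (hN : IsDecreasingFunctional N)
    (hM : IsDecreasingFunctional M) : IsDecreasingFunctional fun f => N f + M f := by
  obtain ⟨φ, hφ, hφa, hNφ⟩ := hN
  obtain ⟨ψ, hψ, hψa, hMψ⟩ := hM
  refine ⟨φ + ψ, hφ.add hψ, fun s hs t ht hst => add_le_add (hφa hs ht hst) (hψa hs ht hst),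
    fun f => ?_⟩
  simp only [hNφ, hMψ]
  rw [funNorm, funNorm, funNorm, rearrNorm_add_weight hφ]

theorem IsDecreasingFunctional.exists_le_mul (hn : 0 < n) {N M : MeasFun n → ℝ≥0∞}
    (hN : IsDecreasingFunctional N) (hM : IsDecreasingFunctional M)
    (h : {f | M f < ∞} ⊆ {f | N f < ∞}) : ∃ C : ℝ≥0, ∀ f, N f ≤ C * M f := by
  obtain ⟨φ, hφ, hφa, hNφ⟩ := hN
  obtain ⟨ψ, hψ, hψa, hMψ⟩ := hM
  obtain ⟨C, hC⟩ := exists_funNorm_le_mul hn hφ hφa hψ hψa fun f hf => by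
    have := @h f (by rwa [mem_ofPred_eq, hMψ])
    rwa [mem_ofPred_eq, hNφ] at this
  exact ⟨C, fun f => by rw [hNφ, hMψ]; exact hC f⟩

/-- Continuity of both inclusions. The Lorentz, Gamma and `L¹` functionals and their sums all belong
to this class, so every equivalence of norms in the theorem follows. -/
theorem IsDecreasingFunctional.normEquiv (hn : 0 < n) {N M : MeasFun n → ℝ≥0∞}
    (hN : IsDecreasingFunctional N) (hM : IsDecreasingFunctional M)
    (h : {f | N f < ∞} = {f | M f < ∞}) : NormEquiv N M := by
  obtain ⟨C, hC⟩ := hN.exists_le_mul hn hM h.ge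
  obtain ⟨D, hD⟩ := hM.exists_le_mul hn hN h.le
  exact .of_le hC hD

theorem IsDecreasingFunctional.isExtNorm {N : MeasFun n → ℝ≥0∞} (hN : IsDecreasingFunctional N)
    (h0 : ∀ f, N f = 0 → f = 0) : IsExtNorm N := by
  obtain ⟨φ, hφ, hφa, hNφ⟩ := hN
  refine ⟨fun f => ⟨h0 f, ?_⟩, fun f g => ?_, fun c f => ?_⟩
  · rintro rfl
    rw [hNφ, funNorm_zero]
  · simp only [hNφ]
    exact funNorm_add_le hφ hφa f g
  · simp only [hNφ]
    exact funNorm_smul hφ c f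

theorem NormEquiv.lt_top_iff {N M : MeasFun n → ℝ≥0∞} (h : NormEquiv N M) (f : MeasFun n) :
    N f < ∞ ↔ M f < ∞ := by
  obtain ⟨C, hC⟩ := h
  exact ⟨fun hf => (hC f).2.trans_lt (ENNReal.mul_lt_top ENNReal.coe_lt_top hf),
    fun hf => (hC f).1.trans_lt (ENNReal.mul_lt_top ENNReal.coe_lt_top hf)⟩

theorem mem_L1Space_iff (f : MeasFun n) : f ∈ L1Space n ↔ l1Norm n f < ∞ :=
  Lp.mem_Lp_iff_eLpNorm_lt_top

end Equivalence

/-! ### Concave minorants and their dyadic slopes -/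

section Affine

/-- The greatest function below all `t ↦ (1 + t / s) W(s)`, `s > 0`. -/
noncomputable def affineInf (W : ℝ → ℝ) (t : ℝ) : ℝ := ⨅ s : Ioi (0 : ℝ), (1 + t / s) * W s

variable {W : ℝ → ℝ}

theorem affineInf_le (hW : ∀ s, 0 < s → 0 ≤ W s) {s t : ℝ} (hs : 0 < s) (ht : 0 < t) :
    affineInf W t ≤ (1 + t / s) * W s := by
  refine ciInf_le (f := fun s : Ioi (0 : ℝ) => (1 + t / s) * W s) ⟨0, ?_⟩ ⟨s, hs⟩
  rintro _ ⟨⟨r, hr⟩, rfl⟩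
  have hr0 : 0 < r := hr
  exact mul_nonneg (by positivity) (hW r hr0)

theorem le_affineInf {a t : ℝ} (h : ∀ s, 0 < s → a ≤ (1 + t / s) * W s) : a ≤ affineInf W t :=
  have : Nonempty (Ioi (0 : ℝ)) := ⟨⟨1, mem_Ioi.2 one_pos⟩⟩
  le_ciInf fun s => h s s.2

theorem affineInf_nonneg (hW : ∀ s, 0 < s → 0 ≤ W s) {t : ℝ} (ht : 0 < t) :
    0 ≤ affineInf W t :=
  le_affineInf fun s hs => mul_nonneg (by positivity) (hW s hs)

theorem affineInf_monotoneOn (hW : ∀ s, 0 < s → 0 ≤ W s) : MonotoneOn (affineInf W) (Ioi 0) :=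
  fun r hr t ht hrt => le_affineInf fun s hs => (affineInf_le hW hs hr).trans (by
    have := hW s hs
    gcongr)

theorem affineInf_two_mul_le (hW : ∀ s, 0 < s → 0 ≤ W s) {t : ℝ} (ht : 0 < t) :
    affineInf W (2 * t) ≤ 2 * affineInf W t := by
  have : affineInf W (2 * t) / 2 ≤ affineInf W t := le_affineInf fun s hs => by
    have h1 := affineInf_le hW hs (show 0 < 2 * t by positivity)
    have h2 : (1 + 2 * t / s) * W s ≤ 2 * ((1 + t / s) * W s) := by
      have := hW s hs
      rw [mul_div_assoc]
      nlinarith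
    linarith
  linarith

theorem affineInf_concaveOn (hW : ∀ s, 0 < s → 0 ≤ W s) : ConcaveOn ℝ (Ioi 0) (affineInf W) := by
  refine ⟨convex_Ioi 0, fun x hx y hy a b ha hb hab => le_affineInf fun s hs => ?_⟩
  have h1 := affineInf_le hW hs hx
  have h2 := affineInf_le hW hs hy
  simp only [smul_eq_mul]
  calc a * affineInf W x + b * affineInf W y
      ≤ a * ((1 + x / s) * W s) + b * ((1 + y / s) * W s) := by gcongr
    _ = ((a + b) + (a * x + b * y) / s) * W s := by ring
    _ = _ := by rw [hab]

/-- The dyadic difference quotient of a function. -/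
noncomputable def dyadicSlope (K : ℝ → ℝ) (t : ℝ) : ℝ := (K (2 * t) - K t) / t

variable {K : ℝ → ℝ}

/-- Chord slopes of a concave function decrease from `[s, 2s]` to `[s, 2t]` to `[t, 2t]`. The dyadic
slope thus serves as a decreasing substitute for the derivative of `K`. -/
theorem dyadicSlope_antitoneOn (hK : ConcaveOn ℝ (Ioi 0) K) :
    AntitoneOn (dyadicSlope K) (Ioi 0) := by
  intro s hs t ht hst
  rcases hst.eq_or_lt with rfl | hlt
  · exact le_rfl
  have hs0 : 0 < s := hs
  have ht0 : 0 < t := ht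
  have h2s : 2 * s ∈ Ioi (0 : ℝ) := mem_Ioi.2 (by positivity)
  have h2t : 2 * t ∈ Ioi (0 : ℝ) := mem_Ioi.2 (by positivity)
  have h1 := hK.neg.secant_mono hs h2s h2t (by linarith) (by linarith) (by linarith)
  have h2 := hK.neg.secant_mono h2t hs ht (by linarith) (by linarith) hlt.le
  simp only [Pi.neg_apply] at h1 h2
  have e1 : (-K (2 * s) - -K s) / (2 * s - s) = -dyadicSlope K s := by
    rw [dyadicSlope]
    ring_nf
  have e2 : (-K t - -K (2 * t)) / (t - 2 * t) = -dyadicSlope K t := by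
    rw [dyadicSlope, show t - 2 * t = -t by ring, div_neg, ← neg_div, ← neg_div]
    ring_nf
  have e3 : (-K s - -K (2 * t)) / (s - 2 * t) = (-K (2 * t) - -K s) / (2 * t - s) := by
    rw [← neg_sub (2 * t) s, div_neg, ← neg_div]
    ring_nf
  rw [e1] at h1
  rw [e2, e3] at h2
  linarith

theorem dyadicSlope_nonneg (hK : MonotoneOn K (Ioi 0)) {t : ℝ} (ht : 0 < t) :
    0 ≤ dyadicSlope K t :=
  div_nonneg (sub_nonneg.2 (hK ht (mem_Ioi.2 (by positivity)) (by linarith))) ht.le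

theorem setLIntegral_dyadicSlope (hm : MonotoneOn K (Ioi 0)) {a t : ℝ} (ha : 0 < a)
    (hat : a ≤ t) :
    ∫⁻ s in Ioc a t, ENNReal.ofReal (dyadicSlope K s) =
      ENNReal.ofReal ((∫ r in t..2 * t, K r / r) - ∫ r in a..2 * a, K r / r) := by
  have hg : ∀ a b, 0 < a → 0 < b → IntervalIntegrable K volume a b := fun a b ha0 hb =>
    (hm.mono fun _ hr => mem_Ioi.2 (lt_of_lt_of_le (lt_min ha0 hb) hr.1)).intervalIntegrable
  have ht := ha.trans_le hat
  have h := integral_sub_comp_two_mul_div hg ha ht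
  have hneg : ∀ r, dyadicSlope K r = -((K r - K (2 * r)) / r) := fun r => by
    rw [dyadicSlope, ← neg_div, neg_sub]
  have hint : IntervalIntegrable (dyadicSlope K) volume a t := by
    have := (intervalIntegrable_comp_two_mul_div_self hg ha ht).sub
      (intervalIntegrable_div_self hg ha ht)
    refine this.congr fun r _ => ?_
    simp only [dyadicSlope, sub_div]
  have h2 : (∫ r in t..2 * t, K r / r) - ∫ r in a..2 * a, K r / r =
      ∫ r in a..t, dyadicSlope K r := by
    simp only [hneg]
    rw [intervalIntegral.integral_neg, h, neg_sub]
  rw [h2, intervalIntegral.integral_of_le hat, ofReal_integral_eq_lintegral_ofReal hint.1]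
  filter_upwards [ae_restrict_mem measurableSet_Ioc] with s hs
  exact dyadicSlope_nonneg hm (ha.trans hs.1)

/-- After telescoping, the boundary term near 0 is nonnegative and is dropped; on `[t, 2t]` one has
`K ≤ K(2t) ≤ 2 K(t)`. -/
theorem setLIntegral_dyadicSlope_le (hm : MonotoneOn K (Ioi 0)) (h0 : ∀ t, 0 < t → 0 ≤ K t)
    (h2 : ∀ t, 0 < t → K (2 * t) ≤ 2 * K t) {t : ℝ} (ht : 0 < t) :
    ∫⁻ s in Ioc 0 t, ENNReal.ofReal (dyadicSlope K s) ≤ ENNReal.ofReal (2 * K t) := by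
  have hg : ∀ a b, 0 < a → 0 < b → IntervalIntegrable K volume a b := fun a b ha0 hb =>
    (hm.mono fun _ hr => mem_Ioi.2 (lt_of_lt_of_le (lt_min ha0 hb) hr.1)).intervalIntegrable
  have hU : Ioc 0 t = ⋃ k : ℕ, Ioc (t / (k + 1)) t := by
    ext r
    simp only [mem_iUnion, mem_Ioc]
    constructor
    · rintro ⟨hr0, hr⟩
      obtain ⟨k, hk⟩ := exists_nat_gt (t / r)
      refine ⟨k, ?_, hr⟩
      rw [div_lt_iff₀ hr0] at hk
      rw [div_lt_iff₀ (by positivity)]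
      nlinarith
    · rintro ⟨k, hk, hr⟩
      exact ⟨lt_trans (by positivity) hk, hr⟩
  have hmono : Monotone fun k : ℕ => Ioc (t / (k + 1)) t := fun i j hij => by
    refine Ioc_subset_Ioc_left ?_
    have : (i : ℝ) ≤ j := by exact_mod_cast hij
    gcongr
  rw [hU, setLIntegral_iUnion_of_directed _ hmono.directed_le]
  refine iSup_le fun k => ?_
  have hk0 : 0 < t / ((k : ℝ) + 1) := by positivity
  rw [setLIntegral_dyadicSlope hm hk0 (div_le_self ht.le (by simp))]
  refine ENNReal.ofReal_le_ofReal ?_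
  have e1 := integral_div_two_mul_le hg ht (m := 2 * K t) fun r hr =>
    (hm (mem_Ioi.2 (ht.trans_le hr.1)) (mem_Ioi.2 (by positivity)) hr.2).trans (h2 t ht)
  have e2 := le_integral_div_two_mul hg hk0 (m := 0) fun r hr => h0 r (hk0.trans_le hr.1)
  nlinarith [log_two_le_one, h0 t ht]

/-- The boundary term at `a` is at most `log 2 · K(2a)`, which disappears as `a → 0`; on `[t, 2t]`
one has `K ≥ K(t)`. -/
theorem le_setLIntegral_dyadicSlope (hm : MonotoneOn K (Ioi 0))
    (hlim : Tendsto K (𝓝[>] 0) (𝓝 0)) {t : ℝ} (ht : 0 < t) :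
    ENNReal.ofReal (Real.log 2 * K t) ≤
      ∫⁻ s in Ioc 0 t, ENNReal.ofReal (dyadicSlope K s) := by
  have hg : ∀ a b, 0 < a → 0 < b → IntervalIntegrable K volume a b := fun a b ha0 hb =>
    (hm.mono fun _ hr => mem_Ioi.2 (lt_of_lt_of_le (lt_min ha0 hb) hr.1)).intervalIntegrable
  have hlim2 : Tendsto (fun a => K (2 * a)) (𝓝[>] 0) (𝓝 0) := by
    refine hlim.comp (tendsto_nhdsWithin_iff.2 ⟨?_, ?_⟩)
    · have : Tendsto (fun a : ℝ => 2 * a) (𝓝 0) (𝓝 (2 * 0)) := tendsto_id.const_mul 2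
      rw [mul_zero] at this
      exact this.mono_left nhdsWithin_le_nhds
    · filter_upwards [self_mem_nhdsWithin] with a ha
      exact mem_Ioi.2 (mul_pos two_pos ha)
  have htend : Tendsto (fun a => ENNReal.ofReal (Real.log 2 * (K t - K (2 * a)))) (𝓝[>] 0)
      (𝓝 (ENNReal.ofReal (Real.log 2 * K t))) := by
    have := ENNReal.tendsto_ofReal ((tendsto_const_nhds (x := K t)).sub hlim2 |>.const_mul
      (Real.log 2))
    rwa [sub_zero] at this
  refine le_of_tendsto htend ?_
  filter_upwards [Ioc_mem_nhdsGT ht] with a ha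
  calc ENNReal.ofReal (Real.log 2 * (K t - K (2 * a)))
      ≤ ENNReal.ofReal ((∫ r in t..2 * t, K r / r) - ∫ r in a..2 * a, K r / r) := by
        refine ENNReal.ofReal_le_ofReal ?_
        have e1 := le_integral_div_two_mul hg ht (m := K t) fun r hr =>
          hm ht (mem_Ioi.2 (ht.trans_le hr.1)) hr.1
        have e2 := integral_div_two_mul_le hg ha.1 (m := K (2 * a)) fun r hr =>
          hm (mem_Ioi.2 (ha.1.trans_le hr.1)) (mem_Ioi.2 (mul_pos two_pos ha.1)) hr.2
        linarith
    _ = ∫⁻ s in Ioc a t, ENNReal.ofReal (dyadicSlope K s) :=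
        (setLIntegral_dyadicSlope hm ha.1 ha.2).symm
    _ ≤ _ := lintegral_mono_set (Ioc_subset_Ioc_left ha.1.le)

theorem isWeight_dyadicSlope (hc : ConcaveOn ℝ (Ioi 0) K) (hm : MonotoneOn K (Ioi 0))
    (h0 : ∀ t, 0 < t → 0 ≤ K t) (h2 : ∀ t, 0 < t → K (2 * t) ≤ 2 * K t) :
    IsWeight (dyadicSlope K) := by
  have hmeas : Measurable fun t : Ioi (0 : ℝ) => dyadicSlope K t :=
    Antitone.measurable fun s t hst => dyadicSlope_antitoneOn hc s.2 t.2 hst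
  refine ⟨fun t ht => dyadicSlope_nonneg hm ht, hmeas, fun t ht => ?_⟩
  have hae : AEMeasurable (dyadicSlope K) (volume.restrict (Ioi 0)) :=
    (aemeasurable_restrict_iff_comap_subtype measurableSet_Ioi).2 hmeas.aemeasurable
  refine ⟨(hae.mono_measure
    (Measure.restrict_mono Ioc_subset_Ioi_self le_rfl)).aestronglyMeasurable, ?_⟩
  rw [hasFiniteIntegral_iff_ofReal]
  · exact (setLIntegral_dyadicSlope_le hm h0 h2 ht).trans_lt ENNReal.ofReal_lt_top
  · filter_upwards [ae_restrict_mem measurableSet_Ioc] with s hs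
    exact dyadicSlope_nonneg hm hs.1

end Affine

/-! ### The three characterisations, and reduction of Banach `Λ¹(w)` to decreasing weights -/

section Main

variable {n : ℕ} {w v : ℝ → ℝ}

theorem normEquiv_gammaNorm_dyadicDiff (hw : IsWeight w) (ha : AntitoneOn w (Ioi 0))
    (hc : valueAtInfty w = 0) : NormEquiv (lambdaNorm n w) (gammaNorm n (dyadicDiff w)) := by
  refine .of_le (C₁ := 4) (C₂ := 1) (fun f => ?_) fun f => ?_
  · simpa [hc] using lambdaNorm_le_gammaNorm_dyadicDiff_add hw ha f
  · simpa [hc] using gammaNorm_dyadicDiff_add_le hw ha f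

theorem normEquiv_gammaNorm_dyadicDiff_add_l1Norm (hw : IsWeight w) (ha : AntitoneOn w (Ioi 0))
    (hc : 0 < valueAtInfty w) :
    NormEquiv (lambdaNorm n w) fun f => gammaNorm n (dyadicDiff w) f + l1Norm n f := by
  obtain ⟨C, hC⟩ := l1Norm_le_of_valueAtInfty_pos (n := n) hw ha hc
  refine .of_le (C₁ := 4 * max 1 (valueAtInfty w).toNNReal) (C₂ := 1 + C) (fun f => ?_) fun f => ?_
  · refine (lambdaNorm_le_gammaNorm_dyadicDiff_add hw ha f).trans ?_
    rw [ENNReal.coe_mul, mul_assoc]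
    refine mul_le_mul' le_rfl ?_
    rw [mul_add]
    exact add_le_add (le_mul_of_one_le_left' (by exact_mod_cast le_max_left _ _))
      (mul_le_mul' (ENNReal.coe_le_coe.2 (le_max_right _ _)) le_rfl)
  · rw [ENNReal.coe_add, add_mul, ENNReal.coe_one, one_mul]
    exact add_le_add (le_self_add.trans (gammaNorm_dyadicDiff_add_le hw ha f)) (hC f)

theorem gammaKernel_dyadicDiff_primitive_lt_top (hw : IsWeight w) (ha : AntitoneOn w (Ioi 0))
    {t : ℝ} (ht : 0 < t) : ∫⁻ s in Ioc 0 t, gammaKernel (dyadicDiff w) s < ∞ :=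
  (setLIntegral_mono' measurableSet_Ioc fun _ hs =>
    le_self_add.trans (gammaKernel_dyadicDiff_add_le hw ha hs.1)).trans_lt
    (hw.setLIntegral_weightFun_lt_top ht)

/-- If `w(∞) > 0`, the `L¹` norm is controlled by the Lorentz functional, hence by the Gamma
functional. The reverse inclusion makes the kernel locally integrable, and then such control is
impossible. -/
theorem valueAtInfty_eq_zero_of_lambdaSpace_eq (hn : 0 < n) (hw : IsWeight w)
    (ha : AntitoneOn w (Ioi 0)) (hv : IsWeight v) (h : LambdaSpace n w = GammaSpace n v) :
    valueAtInfty w = 0 := by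
  by_contra hne
  have hc := (valueAtInfty_nonneg hw ha).lt_of_ne' hne
  have hL := isDecreasingFunctional_lambdaNorm (n := n) hw ha
  have hG := isDecreasingFunctional_gammaNorm (n := n) hv
  obtain ⟨C, hC⟩ := hL.exists_le_mul hn hG h.ge
  obtain ⟨D, hD⟩ := hG.exists_le_mul hn hL h.le
  obtain ⟨B, hB⟩ := l1Norm_le_of_valueAtInfty_pos (n := n) hw ha hc
  refine not_l1Norm_le_gammaNorm (C := B * C) hn hv (fun t ht => ?_) fun f => ?_
  · simp only [gammaNorm_eq_funNorm hv, lambdaNorm_eq_funNorm] at hD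
    exact (primitive_le_of_funNorm_le hn hD ht.le).trans_lt
      (ENNReal.mul_lt_top ENNReal.coe_lt_top (hw.setLIntegral_weightFun_lt_top ht))
  · rw [ENNReal.coe_mul, mul_assoc]
    exact (hB f).trans (by gcongr; exact hC f)

theorem lambdaSpace_eq_L1Space_iff (hn : 0 < n) (hw : IsWeight w) (ha : AntitoneOn w (Ioi 0)) :
    LambdaSpace n w = L1Space n ↔
      0 < valueAtInfty w ∧ MemLp w ∞ (volume.restrict (Ioi 0)) := by
  have hL := isDecreasingFunctional_lambdaNorm (n := n) hw ha
  have h1 := isDecreasingFunctional_l1Norm (n := n)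
  have hS : L1Space n = {f | l1Norm n f < ∞} := Set.ext mem_L1Space_iff
  rw [hS]
  constructor
  · intro h
    obtain ⟨C, hC⟩ := hL.exists_le_mul hn h1 h.ge
    obtain ⟨D, hD⟩ := h1.exists_le_mul hn hL h.le
    exact ⟨valueAtInfty_pos_of_l1Norm_le hn hw ha hD, memLp_top_of_lambdaNorm_le hn hw ha hC⟩
  · rintro ⟨hc, hb⟩
    obtain ⟨C, hC⟩ := lambdaNorm_le_of_memLp_top (n := n) hw hb
    obtain ⟨D, hD⟩ := l1Norm_le_of_valueAtInfty_pos (n := n) hw ha hc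
    exact Set.ext (NormEquiv.of_le hC hD).lt_top_iff

theorem setOf_add_lt_top (N M : MeasFun n → ℝ≥0∞) :
    {f | N f + M f < ∞} = {f | N f < ∞} ∩ {f | M f < ∞} :=
  Set.ext fun _ => ENNReal.add_lt_top

theorem exists_lambdaSpace_eq_inter_iff (hn : 0 < n) (hw : IsWeight w)
    (ha : AntitoneOn w (Ioi 0)) :
    (∃ v, IsWeight v ∧ LambdaSpace n w = GammaSpace n v ∩ L1Space n ∧
        ¬ L1Space n ⊆ GammaSpace n v ∧ ¬ GammaSpace n v ⊆ L1Space n) ↔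
      0 < valueAtInfty w ∧ ¬ MemLp w ∞ (volume.restrict (Ioi 0)) := by
  have hL := isDecreasingFunctional_lambdaNorm (n := n) hw ha
  have h1 := isDecreasingFunctional_l1Norm (n := n)
  have hS : L1Space n = {f | l1Norm n f < ∞} := Set.ext mem_L1Space_iff
  constructor
  · rintro ⟨v, hv, heq, hLG, -⟩
    refine ⟨?_, fun hb => hLG fun f hf => ?_⟩
    · obtain ⟨C, hC⟩ := h1.exists_le_mul hn hL (by
        rw [← hS]
        exact heq.le.trans inter_subset_right)
      exact valueAtInfty_pos_of_l1Norm_le hn hw ha hC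
    · obtain ⟨C, hC⟩ := lambdaNorm_le_of_memLp_top (n := n) hw hb
      have hfL : f ∈ LambdaSpace n w :=
        (hC f).trans_lt (ENNReal.mul_lt_top ENNReal.coe_lt_top ((mem_L1Space_iff f).1 hf))
      exact (heq.le hfL).1
  · rintro ⟨hc, hb⟩
    have hv := hw.dyadicDiff ha
    have hG := isDecreasingFunctional_gammaNorm (n := n) hv
    have hequiv := normEquiv_gammaNorm_dyadicDiff_add_l1Norm (n := n) hw ha hc
    refine ⟨dyadicDiff w, hv, ?_, fun hsub => hb ?_, fun hsub => ?_⟩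
    · rw [hS]
      exact (Set.ext hequiv.lt_top_iff).trans (setOf_add_lt_top _ _)
    -- If `L¹` were contained in the Gamma space, the Lorentz functional would be bounded by the
    -- `L¹` norm, making `w` bounded.
    · obtain ⟨C, hC⟩ := hG.exists_le_mul hn h1 (by rwa [← hS])
      obtain ⟨D, hD⟩ := hequiv
      refine memLp_top_of_lambdaNorm_le (C := D * (C + 1)) hn hw ha fun f => ?_
      refine (hD f).1.trans ?_
      rw [ENNReal.coe_mul, mul_assoc, ENNReal.coe_add, add_mul, ENNReal.coe_one, one_mul]
      exact mul_le_mul' le_rfl (add_le_add (hC f) le_rfl)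
    · obtain ⟨C, hC⟩ := h1.exists_le_mul hn hG (by rwa [← hS])
      exact not_l1Norm_le_gammaNorm hn hv
        (fun t ht => gammaKernel_dyadicDiff_primitive_lt_top hw ha ht) hC

/-- The primitive of a weight. -/
noncomputable def weightPrimitive (w : ℝ → ℝ) (t : ℝ) : ℝ :=
  (∫⁻ s in Ioc 0 t, weightFun w s).toReal

theorem weightPrimitive_nonneg (w : ℝ → ℝ) (t : ℝ) : 0 ≤ weightPrimitive w t :=
  ENNReal.toReal_nonneg

theorem IsWeight.ofReal_weightPrimitive (hw : IsWeight w) {t : ℝ} (ht : 0 < t) :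
    ENNReal.ofReal (weightPrimitive w t) = ∫⁻ s in Ioc 0 t, weightFun w s :=
  ENNReal.ofReal_toReal (hw.setLIntegral_weightFun_lt_top ht).ne

theorem IsWeight.tendsto_weightPrimitive (hw : IsWeight w) :
    Tendsto (weightPrimitive w) (𝓝[>] 0) (𝓝 0) := by
  set ν := (volume : Measure ℝ).withDensity (weightFun w) with hν
  have h := tendsto_measure_biInter_gt (μ := ν) (s := fun t : ℝ => Ioc 0 t) (a := 0)
    (fun r _ => measurableSet_Ioc.nullMeasurableSet)
    (fun i j _ hij => Ioc_subset_Ioc_right hij)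
    ⟨1, one_pos, by
      rw [hν, withDensity_apply _ measurableSet_Ioc]
      exact (hw.setLIntegral_weightFun_lt_top one_pos).ne⟩
  have hempty : ⋂ r > (0 : ℝ), Ioc 0 r = ∅ := by
    refine eq_empty_of_forall_notMem fun x hx => ?_
    simp only [mem_iInter] at hx
    have hx0 := (hx 1 one_pos).1
    have := (hx (x / 2) (by positivity)).2
    linarith
  rw [hempty, measure_empty] at h
  have h2 := (ENNReal.tendsto_toReal ENNReal.zero_ne_top).comp h
  refine h2.congr fun t => ?_
  simp [hν, weightPrimitive, withDensity_apply _ measurableSet_Ioc]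

theorem indFun_eq_add_diff {A B : Set (EuclideanSpace ℝ (Fin n))} (hA : MeasurableSet A)
    (hB : MeasurableSet B) (h : A ⊆ B) :
    indFun B hB = indFun A hA + indFun (B \ A) (hB.diff hA) := by
  simp only [indFun, AEEqFun.mk_add_mk]
  congr 1
  rw [← union_sdiff_cancel h, Set.indicator_union_of_disjoint disjoint_sdiff_self_right,
    union_sdiff_cancel h]
  rfl

/-- A ball of volume `m s` splits into `m` concentric shells of volume `s`, whose indicators all
have Lorentz functional `W(s)`. The triangle inequality for `N` gives `W(m s) ≤ C² m W(s)`, and `m =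
⌈t/s⌉ ≤ 1 + t/s`. -/
theorem weightPrimitive_le_of_isExtNorm (hn : 0 < n) (hw : IsWeight w)
    {N : MeasFun n → ℝ≥0∞} (hN : IsExtNorm N) (h : NormEquiv N (lambdaNorm n w)) :
    ∃ D : ℝ, 0 ≤ D ∧ ∀ t, 0 < t → ∀ s, 0 < s →
      weightPrimitive w t ≤ D * ((1 + t / s) * weightPrimitive w s) := by
  obtain ⟨C, hC⟩ := h
  have hind : ∀ {A : Set (EuclideanSpace ℝ (Fin n))} (hA : MeasurableSet A) {t : ℝ},
      volume A = ENNReal.ofReal t → lambdaNorm n w (indFun A hA) =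
        ∫⁻ s in Ioc 0 t, weightFun w s := fun hA t ht => by
    rw [lambdaNorm_eq_funNorm, funNorm_indFun hA ht]
  refine ⟨C ^ 2, by positivity, fun t ht s hs => ?_⟩
  have hball : ∀ m : ℕ, N (indFun _ (measurableSet_ballOfVolume n (m * s))) ≤
      m * (C * ∫⁻ r in Ioc 0 s, weightFun w r) := by
    intro m
    induction m with
    | zero =>
      refine (hC _).1.trans ?_
      rw [hind (t := 0) _ (by rw [volume_ballOfVolume hn] <;> simp)]
      simp
    | succ m ih =>
      have hms : (0 : ℝ) ≤ m * s := by positivity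
      have hsub : ballOfVolume n (m * s) ⊆ ballOfVolume n ((m + 1 : ℕ) * s) :=
        ballOfVolume_mono n (by push_cast; nlinarith)
      have hd : MeasurableSet (ballOfVolume n ((m + 1 : ℕ) * s) \ ballOfVolume n (m * s)) :=
        (measurableSet_ballOfVolume n _).diff (measurableSet_ballOfVolume n _)
      have hdv : volume (ballOfVolume n ((m + 1 : ℕ) * s) \ ballOfVolume n (m * s)) =
          ENNReal.ofReal s := by
        rw [measure_sdiff hsub (measurableSet_ballOfVolume n _).nullMeasurableSet
          (by rw [volume_ballOfVolume hn hms]; exact ENNReal.ofReal_ne_top),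
          volume_ballOfVolume hn hms, volume_ballOfVolume hn (by positivity),
          ← ENNReal.ofReal_sub _ hms]
        congr 1
        push_cast
        ring
      have hadd : indFun _ (measurableSet_ballOfVolume n ((m + 1 : ℕ) * s)) =
          indFun _ (measurableSet_ballOfVolume n (m * s)) + indFun _ hd :=
        indFun_eq_add_diff _ _ hsub
      rw [hadd]
      refine (hN.add_le _ _).trans ?_
      rw [show ((m + 1 : ℕ) : ℝ≥0∞) = m + 1 from Nat.cast_succ m, add_mul, one_mul]
      refine add_le_add ih ((hC _).1.trans ?_)
      rw [hind hd hdv]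
  set m := ⌈t / s⌉₊ with hm
  have hmt : t ≤ m * s := by
    rw [← div_le_iff₀ hs]
    exact Nat.le_ceil _
  have hm1 : (m : ℝ) ≤ 1 + t / s := by
    rw [add_comm]
    exact (Nat.ceil_lt_add_one (by positivity)).le
  have hle : ENNReal.ofReal (weightPrimitive w t) ≤
      ENNReal.ofReal (C ^ 2 * ((1 + t / s) * weightPrimitive w s)) := by
    calc ENNReal.ofReal (weightPrimitive w t) = ∫⁻ r in Ioc 0 t, weightFun w r :=
          hw.ofReal_weightPrimitive ht
      _ ≤ ∫⁻ r in Ioc 0 (m * s), weightFun w r := lintegral_mono_set (Ioc_subset_Ioc_right hmt)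
      _ = lambdaNorm n w (indFun _ (measurableSet_ballOfVolume n (m * s))) :=
          (hind _ (volume_ballOfVolume hn (by positivity))).symm
      _ ≤ C * (m * (C * ∫⁻ r in Ioc 0 s, weightFun w r)) := (hC _).2.trans (by
          gcongr
          exact hball m)
      _ = ENNReal.ofReal (C * (m * (C * weightPrimitive w s))) := by
          rw [← hw.ofReal_weightPrimitive hs, ENNReal.ofReal_mul C.coe_nonneg,
            ENNReal.ofReal_mul (Nat.cast_nonneg m), ENNReal.ofReal_mul C.coe_nonneg,
            ENNReal.ofReal_coe_nnreal, ENNReal.ofReal_natCast]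
      _ ≤ _ := by
          refine ENNReal.ofReal_le_ofReal ?_
          have := weightPrimitive_nonneg w s
          calc (C : ℝ) * (m * (C * weightPrimitive w s))
              = C ^ 2 * (m * weightPrimitive w s) := by ring
            _ ≤ _ := by gcongr
  have h0 := weightPrimitive_nonneg w s
  exact (ENNReal.ofReal_le_ofReal_iff (by positivity)).1 hle

/-- A weight whose primitive is quasi-concave up to a constant is equivalent to a decreasing
weight. -/
theorem exists_antitoneOn_normEquiv (hw : IsWeight w) {D : ℝ} (hD0 : 0 ≤ D)
    (hD : ∀ t, 0 < t → ∀ s, 0 < s →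
      weightPrimitive w t ≤ D * ((1 + t / s) * weightPrimitive w s)) :
    ∃ u : ℝ → ℝ, IsWeight u ∧ AntitoneOn u (Ioi 0) ∧
      NormEquiv (lambdaNorm n u) (lambdaNorm n w) := by
  have hW : ∀ s, 0 < s → 0 ≤ weightPrimitive w s := fun s _ => weightPrimitive_nonneg w s
  set K := affineInf (weightPrimitive w) with hK
  have hm : MonotoneOn K (Ioi 0) := affineInf_monotoneOn hW
  have hc : ConcaveOn ℝ (Ioi 0) K := affineInf_concaveOn hW
  have h0 : ∀ t, 0 < t → 0 ≤ K t := fun t ht => affineInf_nonneg hW ht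
  have h2 : ∀ t, 0 < t → K (2 * t) ≤ 2 * K t := fun t ht => affineInf_two_mul_le hW ht
  have hKle : ∀ t, 0 < t → K t ≤ 2 * weightPrimitive w t := fun t ht => by
    have := affineInf_le hW ht ht
    rw [div_self ht.ne'] at this
    linarith
  -- `D + 1` keeps the divisor positive when `D = 0`.
  have hleK : ∀ t, 0 < t → weightPrimitive w t ≤ (D + 1) * K t := fun t ht => by
    rw [mul_comm, ← div_le_iff₀ (by positivity)]
    refine le_affineInf fun s hs => ?_
    rw [div_le_iff₀ (by positivity)]
    have h3 : 0 ≤ (1 + t / s) * weightPrimitive w s := mul_nonneg (by positivity) (hW s hs)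
    linarith [hD t ht s hs]
  have hlim : Tendsto K (𝓝[>] 0) (𝓝 0) := by
    have hb : Tendsto (fun t => 2 * weightPrimitive w t) (𝓝[>] 0) (𝓝 0) := by
      simpa using hw.tendsto_weightPrimitive.const_mul 2
    refine tendsto_of_tendsto_of_tendsto_of_le_of_le' tendsto_const_nhds hb ?_ ?_
    · filter_upwards [self_mem_nhdsWithin] with t ht using h0 t ht
    · filter_upwards [self_mem_nhdsWithin] with t ht using hKle t ht
  have hu := isWeight_dyadicSlope hc hm h0 h2
  have hprim : ∀ t, ∫⁻ s in Ioc 0 t, weightFun (dyadicSlope K) s =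
      ∫⁻ s in Ioc 0 t, ENNReal.ofReal (dyadicSlope K s) := fun t =>
    setLIntegral_congr_fun measurableSet_Ioc fun s hs => weightFun_of_pos _ hs.1
  -- The primitive of the slope is at most `2K ≤ 4W` and at least `log 2 · K`, where `W ≤ (D + 1) K`
  -- and `1 / log 2 ≤ 2`; Hardy's lemma transfers both bounds to the norms.
  refine ⟨dyadicSlope K, hu, dyadicSlope_antitoneOn hc,
    .of_le (C₁ := 4) (C₂ := (2 * (D + 1)).toNNReal) (fun f => ?_) fun f => ?_⟩
  · rw [lambdaNorm_eq_funNorm, lambdaNorm_eq_funNorm]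
    refine rearrNorm_le_of_primitive_le hu.measurable_weightFun hw.measurable_weightFun
      fun t ht => ?_
    rw [hprim, ← hw.ofReal_weightPrimitive ht]
    refine (setLIntegral_dyadicSlope_le hm h0 h2 ht).trans ?_
    rw [show ((4 : ℝ≥0) : ℝ≥0∞) = ENNReal.ofReal 4 by simp, ← ENNReal.ofReal_mul (by norm_num)]
    exact ENNReal.ofReal_le_ofReal (by linarith [hKle t ht])
  · rw [lambdaNorm_eq_funNorm, lambdaNorm_eq_funNorm]
    refine rearrNorm_le_of_primitive_le hw.measurable_weightFun hu.measurable_weightFun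
      fun t ht => ?_
    rw [hprim, ← hw.ofReal_weightPrimitive ht]
    calc ENNReal.ofReal (weightPrimitive w t)
        ≤ ENNReal.ofReal (2 * (D + 1) * (Real.log 2 * K t)) := by
          refine ENNReal.ofReal_le_ofReal ((hleK t ht).trans ?_)
          have h3 : 0 ≤ (D + 1) * K t := mul_nonneg (by positivity) (h0 t ht)
          nlinarith [half_le_log_two]
      _ = ENNReal.ofReal (2 * (D + 1)) * ENNReal.ofReal (Real.log 2 * K t) :=
          ENNReal.ofReal_mul (by positivity)
      _ ≤ _ := by
          gcongr
          · rfl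
          · exact le_setLIntegral_dyadicSlope hm hlim ht

/-- The decreasing case is applied to an equivalent decreasing weight `u`; definiteness is inherited
from the given norm by equivalence. When `u(∞) > 0` the sum form works whether or not `u` is
bounded. -/
theorem exists_maxFun_norm (hn : 0 < n) (hw : IsWeight w) (hB : LambdaIsBanach n w) :
    ∃ N : MeasFun n → ℝ≥0∞, IsExtNorm N ∧ NormEquiv N (lambdaNorm n w) ∧
      ((∃ v, IsWeight v ∧ N = gammaNorm n v) ∨
        N = supMaxNorm n ∨
        (∃ v, IsWeight v ∧ N = fun f => gammaNorm n v f + supMaxNorm n f)) := by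
  obtain ⟨M, hM, -, hMw⟩ := hB
  obtain ⟨D, hD0, hD⟩ := weightPrimitive_le_of_isExtNorm hn hw hM hMw
  obtain ⟨u, hu, hua, hequiv⟩ := exists_antitoneOn_normEquiv (n := n) hw hD0 hD
  have hzero : ∀ N : MeasFun n → ℝ≥0∞, NormEquiv N (lambdaNorm n w) →
      ∀ f, N f = 0 → f = 0 := by
    intro N hN f hf
    obtain ⟨C, hC⟩ := hMw.trans hN.symm
    rw [← hM.eq_zero_iff, ← nonpos_iff_eq_zero]
    simpa [hf] using (hC f).1
  have hG := isDecreasingFunctional_gammaNorm (n := n) (hu.dyadicDiff hua)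
  rcases (valueAtInfty_nonneg hu hua).eq_or_lt with hc | hc
  · have h := (normEquiv_gammaNorm_dyadicDiff (n := n) hu hua hc.symm).symm.trans hequiv
    exact ⟨_, hG.isExtNorm (hzero _ h), h, Or.inl ⟨_, hu.dyadicDiff hua, rfl⟩⟩
  · have h := (normEquiv_gammaNorm_dyadicDiff_add_l1Norm (n := n) hu hua hc).symm.trans hequiv
    refine ⟨_, (hG.add isDecreasingFunctional_l1Norm).isExtNorm (hzero _ h), h,
      Or.inr (Or.inr ⟨_, hu.dyadicDiff hua, ?_⟩)⟩
    simp only [supMaxNorm_eq_l1Norm]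

end Main

theorem mainTheorem2 (n : ℕ) (hn : 0 < n) :
    (∀ w : ℝ → ℝ, IsWeight w → AntitoneOn w (Ioi 0) →
      -- (i)
      ((∃ v, IsWeight v ∧ LambdaSpace n w = GammaSpace n v) ↔ valueAtInfty w = 0) ∧
      -- (ii)
      (LambdaSpace n w = L1Space n ↔
        0 < valueAtInfty w ∧ MemLp w ∞ (volume.restrict (Ioi 0))) ∧
      -- (iii)
      ((∃ v, IsWeight v ∧ LambdaSpace n w = GammaSpace n v ∩ L1Space n ∧
          ¬ L1Space n ⊆ GammaSpace n v ∧ ¬ GammaSpace n v ⊆ L1Space n) ↔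
        0 < valueAtInfty w ∧ ¬ MemLp w ∞ (volume.restrict (Ioi 0))) ∧
      -- the equalities of spaces above hold with equivalence of norms
      (∀ v, IsWeight v → LambdaSpace n w = GammaSpace n v →
        NormEquiv (lambdaNorm n w) (gammaNorm n v)) ∧
      (LambdaSpace n w = L1Space n → NormEquiv (lambdaNorm n w) (l1Norm n)) ∧
      (∀ v, IsWeight v → LambdaSpace n w = GammaSpace n v ∩ L1Space n →
        NormEquiv (lambdaNorm n w) (fun f => gammaNorm n v f + l1Norm n f))) ∧
    -- every Banach `Λ¹(w)` has an equivalent norm given by the maximal function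
    (∀ w : ℝ → ℝ, IsWeight w → LambdaIsBanach n w →
      ∃ N : MeasFun n → ℝ≥0∞, IsExtNorm N ∧ NormEquiv N (lambdaNorm n w) ∧
        ((∃ v, IsWeight v ∧ N = gammaNorm n v) ∨
          N = supMaxNorm n ∨
          (∃ v, IsWeight v ∧ N = fun f => gammaNorm n v f + supMaxNorm n f))) := by
  have hS : L1Space n = {f | l1Norm n f < ∞} := Set.ext mem_L1Space_iff
  refine ⟨fun w hw ha => ?_, fun w hw hB => exists_maxFun_norm hn hw hB⟩
  have hL := isDecreasingFunctional_lambdaNorm (n := n) hw ha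
  have h1 := isDecreasingFunctional_l1Norm (n := n)
  refine ⟨⟨?_, fun hc => ?_⟩, lambdaSpace_eq_L1Space_iff hn hw ha,
    exists_lambdaSpace_eq_inter_iff hn hw ha, fun v hv h => ?_, fun h => ?_, fun v hv h => ?_⟩
  · rintro ⟨v, hv, h⟩
    exact valueAtInfty_eq_zero_of_lambdaSpace_eq hn hw ha hv h
  · exact ⟨dyadicDiff w, hw.dyadicDiff ha,
      Set.ext (normEquiv_gammaNorm_dyadicDiff hw ha hc).lt_top_iff⟩
  · exact hL.normEquiv hn (isDecreasingFunctional_gammaNorm hv) h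
  · exact hL.normEquiv hn h1 (by rwa [← hS])
  · refine hL.normEquiv hn ((isDecreasingFunctional_gammaNorm hv).add h1) ?_
    rw [setOf_add_lt_top, ← hS]
    exact h
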